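/- Let $n\ge 1$ be an integer and $\nu$ a real number. For $x>0$ let $PW_x$ be the Paley--Wiener space of the entire functions $f(w)=\int_{-x}^x e^{iwy}\varphi(y)\,dy$, $\varphi\in L^2(-x,x)$, with the scalar product $(f_1,f_2)=\int_{-x}^x\overline{\varphi_1}\varphi_2\,dy$, and let $Z_z(w)=2\,\frac{\sin((\overline z-w)x)}{\overline z-w}$ be its evaluator at $z$. Put $a=e^{-x}\in(0,1)$, $\kappa_j=\frac{\nu+1}2+j-1$ and $z_j=-i\kappa_j$ for $1\le j\le n$. There are unique coefficients $c_j^\nu$ and $d_j^\nu$ (which are real and depend on $a$) such that the entire functions $$E_\nu(w)=e^{-ixw}+\sum_{j=1}^n c_j^\nu Z_{z_j}(w),\qquad F_\nu(w)=(-1)^ne^{ixw}+\sum_{j=1}^n d_j^\nu Z_{z_j}(w)$$ vanish at $z_1,\dots,z_n$. They are real on the imaginary axis, and $K^\nu(z,w)=\frac{\overline{E_\nu(z)}E_\nu(w)-\overline{F_\nu(z)}F_\nu(w)}{i(\overline z-w)}$ is the reproducing kernel of the subspace of $PW_x$ of functions vanishing at $z_1,\dots,z_n$. The mu-function $\mu_\nu$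 is the real function of $a\in(0,1)$ such that, for all $x>0$ and all $w\in\mathbb C$, $$\frac{d}{dx}E_\nu(w)=-iwE_\nu(w)+\mu_\nu F_\nu(w),\qquad \frac{d}{dx}F_\nu(w)=iwF_\nu(w)+\mu_\nu E_\nu(w).$$ The objects $E_{\nu+1}$, $F_{\nu+1}$, $c_j^{\nu+1}$, $d_j^{\nu+1}$, $\mu_{\nu+1}$ are obtained with $\nu+1$ in place of $\nu$ (same $n$). Let $$e_\nu=E_\nu(-i(\tfrac{\nu+1}2+n)),\quad f_\nu=F_\nu(-i(\tfrac{\nu+1}2+n)),\quad g_{\nu+1}=E_{\nu+1}(-i\tfrac\nu2),\quad h_{\nu+1}=F_{\nu+1}(-i\tfrac\nu2).$$ Then for all $a\in(0,1)$ the numbers $h_{\nu+1}$, $f_\nu$, $d_1^\nu$, $d_n^{\nu+1}$ are non-zero, and the quantities $$X=\frac{g_{\nu+1}}{h_{\nu+1}}=\frac1a\,\frac{e_\nu}{f_\nu},\qquad Y=-\frac{c_1^\nu}{d_1^\nu}=-\frac1a\,\frac{c_n^{\nu+1}}{d_n^{\nu+1}}$$ (in each case the two expressions agree) satisfy $1+aXY\ne0$.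 The mu-functions $\mu_\nu$ and $\mu_{\nu+1}$ exist, are unique, and are given on $(0,1)$ by $$\mu_\nu=\frac{2na}{1-a^2}\,\frac{X+aY}{1+aXY},\qquad \mu_{\nu+1}=\frac{2na}{1-a^2}\,\frac{aX+Y}{1+aXY}.$$ The functions $X$ and $Y$ are differentiable on $(0,1)$ and obey the nonlinear differential system $$a\frac{dX}{da}=\nu X-(1-X^2)\frac{2na}{1-a^2}\,\frac{aX+Y}{1+aXY},\qquad a\frac{dY}{da}=-(\nu+1)Y+(1-Y^2)\frac{2na}{1-a^2}\,\frac{X+aY}{1+aXY}.$$ -/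

import Mathlib

open MeasureTheory

namespace PWZeros

/-- The Hilbert space `L²(-x, x)`. -/
abbrev L2 (x : ℝ) : Type :=
  Lp ℂ 2 (volume.restrict (Set.Ioo (-x) x))

/-- The entire function `w ↦ ∫_{-x}^{x} e^{iwy} φ(y) dy`. The Paley-Wiener space `PW_x` is the space
of these functions for `φ` in `L²(-x, x)`, with the scalar product `(φ, ψ) = ∫ conj φ · ψ`. -/
noncomputable def transform (x : ℝ) (φ : L2 x) (w : ℂ) : ℂ :=
  ∫ y in Set.Ioo (-x) x, Complex.exp (Complex.I * w * (y : ℂ)) * φ y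

/-- The trivial zeros `z_j = -i κ_j`. -/
noncomputable def zero {n : ℕ} (κ : Fin n → ℝ) (j : Fin n) : ℂ :=
  -Complex.I * (κ j : ℂ)

/-- The elements of `PW_x` (represented by their `φ`) which vanish at all the trivial zeros. -/
def vanishing {n : ℕ} (κ : Fin n → ℝ) (x : ℝ) : Set (L2 x) :=
  {φ | ∀ j, transform x φ (zero κ j) = 0}

/-- The evaluator of `PW_x` at `z`: the transform of `y ↦ exp (-i z̄ y)` on `(-x, x)`,
that is `w ↦ 2 sin ((z̄ - w) x) / (z̄ - w)`. -/
noncomputable def evaluator (x : ℝ) (z w : ℂ) : ℂ :=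
  ∫ y in (-x)..x, Complex.exp (Complex.I * w * (y : ℂ)) *
    Complex.exp (-Complex.I * (starRingEnd ℂ) z * (y : ℂ))

/-- `e^{-ixw}` plus a linear combination of the evaluators at the trivial zeros. -/
noncomputable def perturbE {n : ℕ} (κ : Fin n → ℝ) (x : ℝ) (c : Fin n → ℂ) (w : ℂ) : ℂ :=
  Complex.exp (-Complex.I * (x : ℂ) * w) + ∑ j, c j * evaluator x (zero κ j) w

/-- `(-1)^n e^{ixw}` plus a linear combination of the evaluators at the trivial zeros. -/
noncomputable def perturbF {n : ℕ} (κ : Fin n → ℝ) (x : ℝ) (d : Fin n → ℂ) (w : ℂ) : ℂ :=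
  (-1) ^ n * Complex.exp (Complex.I * (x : ℂ) * w) + ∑ j, d j * evaluator x (zero κ j) w

/-- The Gram matrix of the evaluators at the trivial zeros. -/
noncomputable def gram {n : ℕ} (κ : Fin n → ℝ) (x : ℝ) : Matrix (Fin n) (Fin n) ℝ :=
  Matrix.of fun i j => ∫ y in (-x)..x, Real.exp ((κ i + κ j) * y)

/-- The coefficients `c_j`: the solution of `∑ j, c_j ∫_{-x}^{x} e^{(κ_i + κ_j) y} dy = -e^{-κ_i x}`,
which says that `perturbE` vanishes at the trivial zeros. -/
noncomputable def coeffC {n : ℕ} (κ : Fin n → ℝ) (x : ℝ) : Fin n → ℝ :=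
  (gram κ x)⁻¹.mulVec fun i => -Real.exp (-(κ i * x))

/-- The coefficients `d_j`: the solution of
`∑ j, d_j ∫_{-x}^{x} e^{(κ_i + κ_j) y} dy = -(-1)^n e^{κ_i x}`,
which says that `perturbF` vanishes at the trivial zeros. -/
noncomputable def coeffD {n : ℕ} (κ : Fin n → ℝ) (x : ℝ) : Fin n → ℝ :=
  (gram κ x)⁻¹.mulVec fun i => -((-1) ^ n * Real.exp (κ i * x))

/-- The (incomplete) function `E_σ` of `PW_x(σ)`. -/
noncomputable def E {n : ℕ} (κ : Fin n → ℝ) (x : ℝ) (w : ℂ) : ℂ :=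
  perturbE κ x (fun j => (coeffC κ x j : ℂ)) w

/-- The (incomplete) function `F_σ` of `PW_x(σ)`. -/
noncomputable def F {n : ℕ} (κ : Fin n → ℝ) (x : ℝ) (w : ℂ) : ℂ :=
  perturbF κ x (fun j => (coeffD κ x j : ℂ)) w

/-- `μ`, as a function of `a = e^{-x}` in `(0, 1)`, is the mu-function of the spaces `PW_x(σ)`:
the coefficient of the Krein differential system of `E_σ` and `F_σ` with respect to `x > 0`. -/
def IsMuFunction {n : ℕ} (κ : Fin n → ℝ) (μ : ℝ → ℝ) : Prop :=
  ∀ x : ℝ, 0 < x → ∀ w : ℂ,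
    HasDerivAt (fun s : ℝ => E κ s w)
      (-Complex.I * w * E κ x w + (μ (Real.exp (-x)) : ℂ) * F κ x w) x ∧
    HasDerivAt (fun s : ℝ => F κ s w)
      (Complex.I * w * F κ x w + (μ (Real.exp (-x)) : ℂ) * E κ x w) x

/-- The arithmetic progression `(ν+1)/2, (ν+1)/2 + 1, …, (ν+1)/2 + n - 1`. -/
noncomputable def kappa (n : ℕ) (ν : ℝ) (j : Fin n) : ℝ :=
  (ν + 1) / 2 + (j : ℝ)

/-- `E_ν(it)` for real `t`, as a (real valued) function of `a = e^{-x}`. -/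
noncomputable def Eim (n : ℕ) (ν t a : ℝ) : ℝ :=
  (E (kappa n ν) (-Real.log a) (Complex.I * (t : ℂ))).re

/-- `F_ν(it)` for real `t`, as a (real valued) function of `a = e^{-x}`. -/
noncomputable def Fim (n : ℕ) (ν t a : ℝ) : ℝ :=
  (F (kappa n ν) (-Real.log a) (Complex.I * (t : ℂ))).re

/-- The coefficients `c_j^ν` as functions of `a = e^{-x}`. -/
noncomputable def c (n : ℕ) (ν : ℝ) (j : Fin n) (a : ℝ) : ℝ :=
  coeffC (kappa n ν) (-Real.log a) j

/-- The coefficients `d_j^ν` as functions of `a = e^{-x}`. -/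
noncomputable def d (n : ℕ) (ν : ℝ) (j : Fin n) (a : ℝ) : ℝ :=
  coeffD (kappa n ν) (-Real.log a) j

/-- `e_ν = E_ν(-i((ν+1)/2 + n))`. -/
noncomputable def eNu (n : ℕ) (ν a : ℝ) : ℝ := Eim n ν (-((ν + 1) / 2 + n)) a

/-- `f_ν = F_ν(-i((ν+1)/2 + n))`. -/
noncomputable def fNu (n : ℕ) (ν a : ℝ) : ℝ := Fim n ν (-((ν + 1) / 2 + n)) a

/-- `g_{ν+1} = E_{ν+1}(-iν/2)`. -/
noncomputable def gNuSucc (n : ℕ) (ν a : ℝ) : ℝ := Eim n (ν + 1) (-(ν / 2)) a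

/-- `h_{ν+1} = F_{ν+1}(-iν/2)`. -/
noncomputable def hNuSucc (n : ℕ) (ν a : ℝ) : ℝ := Fim n (ν + 1) (-(ν / 2)) a

/-- `X = g_{ν+1} / h_{ν+1}`. -/
noncomputable def X (n : ℕ) (ν a : ℝ) : ℝ := gNuSucc n ν a / hNuSucc n ν a

/-- `Y = -c_1^ν / d_1^ν`. -/
noncomputable def Y (n : ℕ) (hn : 0 < n) (ν a : ℝ) : ℝ :=
  -(c n ν ⟨0, hn⟩ a / d n ν ⟨0, hn⟩ a)

/-- `(E_σ, F_σ)` gives the reproducing kernel of the space of elements of `PW_x` vanishing at the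
trivial zeros (which is isometric to `PW_x(σ)` by division by `∏ (w - z_j)`):
for each `z`, the evaluator at `z` is the function
`w ↦ (conj (E_σ z) * E_σ w - conj (F_σ z) * F_σ w) / (i (z̄ - w))` of that space. -/
def ComputesEvaluators {n : ℕ} (κ : Fin n → ℝ) (x : ℝ) : Prop :=
  ∀ z : ℂ, ∃ k ∈ vanishing κ x,
    (∀ φ ∈ vanishing κ x, inner ℂ k φ = transform x φ z) ∧
    ∀ w : ℂ, Complex.I * ((starRingEnd ℂ) z - w) * transform x k w =
      (starRingEnd ℂ) (E κ x z) * E κ x w - (starRingEnd ℂ) (F κ x z) * F κ x w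

end PWZeros

namespace PWZeros

/-! ### Evaluators on the imaginary axis -/

/-! Two mechanisms meet. The first works for any real exponents κ with invertible Gram matrix G. The
derivative of G in x is a sum of two rank-one matrices, and (κ_i + κ_j) G_ij is the difference of
the same two. Differentiating the linear systems that define c and d therefore gives c_j' = κ_j c_j
+ μ d_j and d_j' = -κ_j d_j + μ c_j with μ = `muCoeff` (`hasDerivAt_coeffC`, `hasDerivAt_coeffD`),
and the Krein system of E and F follows (`hasDerivAt_E`, `hasDerivAt_F`). A quotient of the two
components of such a system obeys a Riccati equation. X is the quotient E/F for ν + 1 at -iν/2, and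
Y is -c_1/d_1 for ν; this is the nonlinear system, once both mu-functions are known through X and Y.

The second mechanism supplies them. For the arithmetic progression, u = e^y turns G into the Hankel
matrix of the weight u^ν on [a, 1/a] (`gram_kappa`), so c and d are, up to factors, the coefficients
of polynomial reproducing kernels at a and 1/a. Let P and Q be the monic orthogonal polynomials of
degrees n and n - 1 for u^ν and u^(ν+1). The kernels for ν and for ν + 1 are Christoffel-Darboux
quotients in this same pair (`exists_kernel`, `exists_kernel_succ`), so everything depends on the
values of P and Q at a and 1/a, on P(0), and on h = ∫ Q² u^(ν+1) (`exists_values`). One finds X =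
(-1)^n a^ν P(a)/P(1/a) and Y = -(-1)^n a^(ν+1) Q(a)/Q(1/a). Integration by parts gives a^(-ν-1)
P(1/a)Q(1/a) - a^(ν+1) P(a)Q(a) = n h (`IsMonicOrthogonal.boundary`), that is 1 + aXY = a^(ν+1) n h
/ (P(1/a)Q(1/a)). This is non-zero, and it eliminates h from the kernel values that give μ
(`formulas_X_Y`). -/

theorem zero_eq_I_mul {n : ℕ} (κ : Fin n → ℝ) (j : Fin n) :
    zero κ j = Complex.I * ((-κ j : ℝ) : ℂ) := by
  simp [zero]

theorem evaluator_zero_eq {n : ℕ} (κ : Fin n → ℝ) (x : ℝ) (j : Fin n) (w : ℂ) :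
    evaluator x (zero κ j) w = ∫ y in (-x)..x, Complex.exp ((Complex.I * w + κ j) * (y : ℂ)) := by
  unfold evaluator
  congr 1
  funext y
  rw [← Complex.exp_add]
  congr 1
  simp only [zero, map_mul, map_neg, Complex.conj_I, Complex.conj_ofReal]
  linear_combination (-(κ j : ℂ) * y) * Complex.I_mul_I

theorem evaluator_zero_imaginary {n : ℕ} (κ : Fin n → ℝ) (x : ℝ) (j : Fin n) (t : ℝ) :
    evaluator x (zero κ j) (Complex.I * (t : ℂ)) =
      ((∫ y in (-x)..x, Real.exp ((κ j - t) * y) : ℝ) : ℂ) := by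
  rw [evaluator_zero_eq, ← intervalIntegral.integral_ofReal]
  congr 1
  funext y
  push_cast
  congr 1
  linear_combination ((t : ℂ) * y) * Complex.I_mul_I

theorem evaluator_zero_zero {n : ℕ} (κ : Fin n → ℝ) (x : ℝ) (i j : Fin n) :
    evaluator x (zero κ j) (zero κ i) = (gram κ x i j : ℂ) := by
  rw [zero_eq_I_mul κ i, evaluator_zero_imaginary]
  simp only [gram, Matrix.of_apply]
  congr 3
  funext y
  congr 1
  ring

theorem exp_neg_at_zero {n : ℕ} (κ : Fin n → ℝ) (x : ℝ) (i : Fin n) :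
    Complex.exp (-Complex.I * (x : ℂ) * zero κ i) = (Real.exp (-(κ i * x)) : ℂ) := by
  push_cast
  congr 1
  simp only [zero]
  linear_combination ((κ i : ℂ) * x) * Complex.I_mul_I

theorem exp_at_zero {n : ℕ} (κ : Fin n → ℝ) (x : ℝ) (i : Fin n) :
    Complex.exp (Complex.I * (x : ℂ) * zero κ i) = (Real.exp (κ i * x) : ℂ) := by
  push_cast
  congr 1
  simp only [zero]
  linear_combination (-(κ i : ℂ) * x) * Complex.I_mul_I

theorem E_imaginary {n : ℕ} (κ : Fin n → ℝ) (x t : ℝ) :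
    E κ x (Complex.I * (t : ℂ)) =
      ((Real.exp (x * t) +
        ∑ j, coeffC κ x j * ∫ y in (-x)..x, Real.exp ((κ j - t) * y) : ℝ) : ℂ) := by
  simp only [E, perturbE, evaluator_zero_imaginary]
  push_cast
  congr 2
  linear_combination (-(t : ℂ) * x) * Complex.I_mul_I

theorem F_imaginary {n : ℕ} (κ : Fin n → ℝ) (x t : ℝ) :
    F κ x (Complex.I * (t : ℂ)) =
      (((-1) ^ n * Real.exp (-(x * t)) +
        ∑ j, coeffD κ x j * ∫ y in (-x)..x, Real.exp ((κ j - t) * y) : ℝ) : ℂ) := by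
  simp only [F, perturbF, evaluator_zero_imaginary]
  push_cast
  congr 3
  linear_combination ((t : ℂ) * x) * Complex.I_mul_I

/-! ### The Gram system -/

theorem gram_isSymm {n : ℕ} (κ : Fin n → ℝ) (x : ℝ) : (gram κ x).transpose = gram κ x := by
  ext i j
  simp only [gram, Matrix.transpose_apply, Matrix.of_apply, add_comm (κ j)]

theorem gram_mulVec_coeffC {n : ℕ} (κ : Fin n → ℝ) (x : ℝ) (h : IsUnit (gram κ x).det) :
    (gram κ x).mulVec (coeffC κ x) = fun i => -Real.exp (-(κ i * x)) := by
  rw [coeffC, Matrix.mulVec_mulVec, Matrix.mul_nonsing_inv _ h, Matrix.one_mulVec]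

theorem gram_mulVec_coeffD {n : ℕ} (κ : Fin n → ℝ) (x : ℝ) (h : IsUnit (gram κ x).det) :
    (gram κ x).mulVec (coeffD κ x) = fun i => -((-1) ^ n * Real.exp (κ i * x)) := by
  rw [coeffD, Matrix.mulVec_mulVec, Matrix.mul_nonsing_inv _ h, Matrix.one_mulVec]

theorem gram_mulVec_injective {n : ℕ} {κ : Fin n → ℝ} {x : ℝ} (h : IsUnit (gram κ x).det) :
    Function.Injective (gram κ x).mulVec :=
  Matrix.mulVec_injective_iff_isUnit.2 ((Matrix.isUnit_iff_isUnit_det _).2 h)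

/-- The Gram matrix with complex entries. -/
noncomputable def gramC {n : ℕ} (κ : Fin n → ℝ) (x : ℝ) : Matrix (Fin n) (Fin n) ℂ :=
  (gram κ x).map Complex.ofRealHom

theorem isUnit_det_gramC {n : ℕ} {κ : Fin n → ℝ} {x : ℝ} (h : IsUnit (gram κ x).det) :
    IsUnit (gramC κ x).det := by
  have : (gramC κ x).det = Complex.ofRealHom (gram κ x).det := (RingHom.map_det _ _).symm
  rw [this]
  exact h.map _

theorem gramC_mulVec_ofReal {n : ℕ} (κ : Fin n → ℝ) (x : ℝ) (v : Fin n → ℝ) :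
    (gramC κ x).mulVec (fun j => (v j : ℂ)) = fun i => (((gram κ x).mulVec v i : ℝ) : ℂ) := by
  funext i
  simp [gramC, Matrix.mulVec, dotProduct]

theorem gramC_mulVec_injective {n : ℕ} {κ : Fin n → ℝ} {x : ℝ} (h : IsUnit (gram κ x).det) :
    Function.Injective (gramC κ x).mulVec :=
  Matrix.mulVec_injective_iff_isUnit.2 ((Matrix.isUnit_iff_isUnit_det _).2 (isUnit_det_gramC h))

theorem sum_evaluator_at_zero {n : ℕ} (κ : Fin n → ℝ) (x : ℝ) (c : Fin n → ℂ) (i : Fin n) :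
    ∑ j, c j * evaluator x (zero κ j) (zero κ i) = (gramC κ x).mulVec c i := by
  simp only [evaluator_zero_zero, gramC, Matrix.mulVec, dotProduct, Matrix.map_apply]
  exact Finset.sum_congr rfl fun j _ => mul_comm _ _

/-- At the trivial zeros the exponential and the evaluators are real, so the vanishing conditions
form the real Gram system; invertibility over ℂ gives uniqueness among complex coefficients. -/
theorem perturbE_vanishes_iff {n : ℕ} {κ : Fin n → ℝ} {x : ℝ} (h : IsUnit (gram κ x).det)
    (c : Fin n → ℂ) :
    (∀ j, perturbE κ x c (zero κ j) = 0) ↔ c = fun j => (coeffC κ x j : ℂ) := by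
  rw [← (gramC_mulVec_injective h).eq_iff, gramC_mulVec_ofReal, gram_mulVec_coeffC κ x h,
    funext_iff]
  refine forall_congr' fun i => ?_
  rw [perturbE, sum_evaluator_at_zero, exp_neg_at_zero, Complex.ofReal_neg, ← eq_neg_iff_add_eq_zero,
    eq_comm, neg_eq_iff_eq_neg]

theorem perturbF_vanishes_iff {n : ℕ} {κ : Fin n → ℝ} {x : ℝ} (h : IsUnit (gram κ x).det)
    (d : Fin n → ℂ) :
    (∀ j, perturbF κ x d (zero κ j) = 0) ↔ d = fun j => (coeffD κ x j : ℂ) := by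
  rw [← (gramC_mulVec_injective h).eq_iff, gramC_mulVec_ofReal, gram_mulVec_coeffD κ x h,
    funext_iff]
  refine forall_congr' fun i => ?_
  rw [perturbF, sum_evaluator_at_zero, exp_at_zero, Complex.ofReal_neg, ← eq_neg_iff_add_eq_zero,
    eq_comm, neg_eq_iff_eq_neg]
  push_cast
  rfl

theorem E_zero {n : ℕ} {κ : Fin n → ℝ} {x : ℝ} (h : IsUnit (gram κ x).det) (j : Fin n) :
    E κ x (zero κ j) = 0 :=
  (perturbE_vanishes_iff h _).2 rfl j

theorem F_zero {n : ℕ} {κ : Fin n → ℝ} {x : ℝ} (h : IsUnit (gram κ x).det) (j : Fin n) :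
    F κ x (zero κ j) = 0 :=
  (perturbF_vanishes_iff h _).2 rfl j

/-- A combination of the exponentials and of the evaluators at the trivial zeros which vanishes at
the trivial zeros is a combination of `E` and `F`. -/
theorem eq_combination_E_F {n : ℕ} {κ : Fin n → ℝ} {x : ℝ} (h : IsUnit (gram κ x).det)
    (A B : ℂ) (γ : Fin n → ℂ)
    (hv : ∀ i, A * Complex.exp (-Complex.I * (x : ℂ) * zero κ i) +
      B * ((-1) ^ n * Complex.exp (Complex.I * (x : ℂ) * zero κ i)) +
      ∑ j, γ j * evaluator x (zero κ j) (zero κ i) = 0) (w : ℂ) :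
    A * Complex.exp (-Complex.I * (x : ℂ) * w) +
      B * ((-1) ^ n * Complex.exp (Complex.I * (x : ℂ) * w)) +
      ∑ j, γ j * evaluator x (zero κ j) w = A * E κ x w + B * F κ x w := by
  -- Subtracting A E + B F leaves a combination of evaluators alone that vanishes at all trivial
  -- zeros, so its coefficient vector is killed by the Gram matrix.
  have hγ : γ = fun j => A * (coeffC κ x j : ℂ) + B * (coeffD κ x j : ℂ) := by
    apply gramC_mulVec_injective h
    funext i
    have h1 := hv i
    have h2 := E_zero h i
    have h3 := F_zero h i
    rw [E, perturbE] at h2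
    rw [F, perturbF] at h3
    rw [← sum_evaluator_at_zero, ← sum_evaluator_at_zero]
    simp only [add_mul, Finset.sum_add_distrib, mul_assoc A, mul_assoc B, ← Finset.mul_sum]
    linear_combination h1 - A * h2 - B * h3
  subst hγ
  simp only [E, F, perturbE, perturbF, add_mul, Finset.sum_add_distrib, mul_assoc A, mul_assoc B,
    ← Finset.mul_sum]
  ring

/-- `i (z̄ - w)` times the evaluator at `z`. -/
theorem mul_evaluator (x : ℝ) (z w : ℂ) :
    Complex.I * ((starRingEnd ℂ) z - w) * evaluator x z w =
      (starRingEnd ℂ) (Complex.exp (-Complex.I * (x : ℂ) * z)) *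
        Complex.exp (-Complex.I * (x : ℂ) * w) -
      (starRingEnd ℂ) (Complex.exp (Complex.I * (x : ℂ) * z)) *
        Complex.exp (Complex.I * (x : ℂ) * w) := by
  have key : ∫ y in (-x)..x, Complex.I * (w - (starRingEnd ℂ) z) *
      Complex.exp (Complex.I * (w - (starRingEnd ℂ) z) * (y : ℂ)) =
      Complex.exp (Complex.I * (w - (starRingEnd ℂ) z) * (x : ℂ)) -
        Complex.exp (Complex.I * (w - (starRingEnd ℂ) z) * ((-x : ℝ) : ℂ)) := by
    refine intervalIntegral.integral_eq_sub_of_hasDerivAt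
      (f := fun y : ℝ => Complex.exp (Complex.I * (w - (starRingEnd ℂ) z) * (y : ℂ))) ?_ ?_
    · intro y _
      have h1 : HasDerivAt (fun y : ℝ => Complex.I * (w - (starRingEnd ℂ) z) * (y : ℂ))
          (Complex.I * (w - (starRingEnd ℂ) z)) y := by
        simpa using (Complex.ofRealCLM.hasDerivAt (x := y)).const_mul
          (Complex.I * (w - (starRingEnd ℂ) z))
      exact h1.cexp.congr_deriv (mul_comm _ _)
    · exact Continuous.intervalIntegrable (by fun_prop) _ _
  rw [intervalIntegral.integral_const_mul] at key
  have hev : evaluator x z w = ∫ y in (-x)..x,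
      Complex.exp (Complex.I * (w - (starRingEnd ℂ) z) * (y : ℂ)) := by
    unfold evaluator
    congr 1
    funext y
    rw [← Complex.exp_add]
    congr 1
    ring
  rw [hev, ← Complex.exp_conj, ← Complex.exp_conj, ← Complex.exp_add, ← Complex.exp_add]
  simp only [map_mul, map_neg, Complex.conj_I, Complex.conj_ofReal]
  have e1 : - -Complex.I * (x : ℂ) * (starRingEnd ℂ) z + -Complex.I * (x : ℂ) * w =
      Complex.I * (w - (starRingEnd ℂ) z) * ((-x : ℝ) : ℂ) := by push_cast; ring
  have e2 : -Complex.I * (x : ℂ) * (starRingEnd ℂ) z + Complex.I * (x : ℂ) * w =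
      Complex.I * (w - (starRingEnd ℂ) z) * (x : ℂ) := by ring
  rw [e1, e2]
  linear_combination -key

theorem conj_zero {n : ℕ} (κ : Fin n → ℝ) (j : Fin n) :
    (starRingEnd ℂ) (zero κ j) = Complex.I * (κ j : ℂ) := by
  simp [zero]

/-- Up to the two exponentials, multiplication by -iw acts on the evaluator at z_j as the scalar
κ_j. Both the kernel formula and the Krein system rest on this rule. -/
theorem mul_evaluator_zero {n : ℕ} (κ : Fin n → ℝ) (x : ℝ) (j : Fin n) (w : ℂ) :
    -Complex.I * w * evaluator x (zero κ j) w =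
      κ j * evaluator x (zero κ j) w +
        (Real.exp (-(κ j * x)) : ℂ) * Complex.exp (-Complex.I * (x : ℂ) * w) -
        (Real.exp (κ j * x) : ℂ) * Complex.exp (Complex.I * (x : ℂ) * w) := by
  have h := mul_evaluator x (zero κ j) w
  rw [exp_neg_at_zero, exp_at_zero, conj_zero, Complex.conj_ofReal, Complex.conj_ofReal] at h
  linear_combination h - (κ j : ℂ) * evaluator x (zero κ j) w * Complex.I_mul_I

theorem conj_evaluator (x : ℝ) (z w : ℂ) :
    (starRingEnd ℂ) (evaluator x z w) = evaluator x w z := by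
  unfold evaluator
  have := Complex.conjCLE.toContinuousLinearMap.intervalIntegral_comp_comm
    (a := -x) (b := x) (μ := volume) (f := fun y : ℝ => Complex.exp (Complex.I * w * (y : ℂ)) *
    Complex.exp (-Complex.I * (starRingEnd ℂ) z * (y : ℂ)))
    (Continuous.intervalIntegrable (by fun_prop) _ _)
  refine (Eq.trans ?_ this.symm).trans ?_
  · rfl
  · congr 1
    funext y
    simp only [ContinuousLinearEquiv.coe_coe, Complex.conjCLE_apply, map_mul, ← Complex.exp_conj,
      map_neg, Complex.conj_I, Complex.conj_ofReal, Complex.conj_conj, neg_neg]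
    ring

/-! ### The reproducing kernel -/

theorem memLp_exp (x : ℝ) (z : ℂ) :
    MemLp (fun y : ℝ => Complex.exp (-Complex.I * (starRingEnd ℂ) z * (y : ℂ))) 2
      (volume.restrict (Set.Ioo (-x) x)) := by
  have hc : Continuous fun y : ℝ => Complex.exp (-Complex.I * (starRingEnd ℂ) z * (y : ℂ)) := by
    fun_prop
  obtain ⟨C, hC⟩ := (isCompact_Icc (a := -x) (b := x)).exists_bound_of_continuousOn hc.continuousOn
  refine MemLp.of_bound hc.aestronglyMeasurable C ?_
  filter_upwards [ae_restrict_mem measurableSet_Ioo] with y hy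
  exact hC y (Set.Ioo_subset_Icc_self hy)

/-- The element of `L²(-x, x)` which represents the evaluator at `z`. -/
noncomputable def evalVec (x : ℝ) (z : ℂ) : L2 x :=
  (memLp_exp x z).toLp

theorem inner_evalVec (x : ℝ) (z : ℂ) (φ : L2 x) : inner ℂ (evalVec x z) φ = transform x φ z := by
  rw [MeasureTheory.L2.inner_def, transform]
  refine integral_congr_ae ?_
  filter_upwards [(memLp_exp x z).coeFn_toLp] with y hy
  rw [evalVec, hy, RCLike.inner_apply, mul_comm, ← Complex.exp_conj]
  simp

theorem transform_evalVec (x : ℝ) (hx : 0 < x) (z w : ℂ) :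
    transform x (evalVec x z) w = evaluator x z w := by
  rw [evaluator, intervalIntegral.integral_of_le (by linarith), transform,
    integral_Ioc_eq_integral_Ioo]
  refine integral_congr_ae ?_
  filter_upwards [(memLp_exp x z).coeFn_toLp] with y hy
  rw [evalVec, hy]

theorem transform_combination (x : ℝ) (hx : 0 < x) {n : ℕ} (κ : Fin n → ℝ) (α : Fin n → ℂ)
    (z w : ℂ) :
    transform x (evalVec x z - ∑ j, α j • evalVec x (zero κ j)) w =
      evaluator x z w - ∑ j, α j * evaluator x (zero κ j) w := by
  rw [← inner_evalVec, inner_sub_right, inner_sum, inner_evalVec, transform_evalVec x hx]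
  simp only [inner_smul_right, inner_evalVec, transform_evalVec x hx]

/-- The evaluator of the subspace is the orthogonal projection of Z_z, namely Z_z - ∑ α_j Z_{z_j}.
Times i(z̄ - w) it becomes a combination of the exponentials and the Z_{z_j} that vanishes at the
trivial zeros, hence a combination of E and F whose coefficients are read off the exponentials. -/
theorem computesEvaluators_of_isUnit_det {n : ℕ} {κ : Fin n → ℝ} {x : ℝ} (hx : 0 < x)
    (h : IsUnit (gram κ x).det) : ComputesEvaluators κ x := by
  intro z
  set β : Fin n → ℂ := fun i => evaluator x z (zero κ i) with hβ
  set α : Fin n → ℂ := (gramC κ x)⁻¹.mulVec β with hα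
  have hGα : (gramC κ x).mulVec α = β := by
    rw [hα, Matrix.mulVec_mulVec, Matrix.mul_nonsing_inv _ (isUnit_det_gramC h), Matrix.one_mulVec]
  have hsymm : (gramC κ x).transpose = gramC κ x := by
    rw [gramC, ← Matrix.transpose_map, gram_isSymm]
  -- Symmetry of G: α · Gv = Gα · v = β · v. It identifies the coefficients of the two exponentials
  -- with the conjugate values of E and F at z.
  have hpair : ∀ (v r : Fin n → ℝ), (gram κ x).mulVec v = r →
      ∑ j, α j * (r j : ℂ) = ∑ j, (v j : ℂ) * β j := by
    intro v r hr
    have h1 : (fun j => (r j : ℂ)) = (gramC κ x).mulVec (fun j => (v j : ℂ)) := by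
      rw [gramC_mulVec_ofReal, hr]
    have h2 : α ⬝ᵥ (fun j => (r j : ℂ)) = (fun j => (v j : ℂ)) ⬝ᵥ β := by
      rw [h1, Matrix.dotProduct_mulVec, ← Matrix.mulVec_transpose, hsymm, hGα, dotProduct_comm]
    exact h2
  have hkz : ∀ i, evaluator x z (zero κ i) -
      ∑ j, α j * evaluator x (zero κ j) (zero κ i) = 0 := by
    intro i
    rw [sum_evaluator_at_zero, hGα, sub_self]
  refine ⟨evalVec x z - ∑ j, α j • evalVec x (zero κ j), ?_, ?_, ?_⟩
  · intro j
    rw [transform_combination x hx, hkz]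
  · intro φ hφ
    rw [inner_sub_left, sum_inner, inner_evalVec]
    simp only [inner_smul_left, inner_evalVec, hφ _, mul_zero, Finset.sum_const_zero, sub_zero]
  · intro w
    rw [transform_combination x hx]
    have hA : (starRingEnd ℂ) (E κ x z) =
        (starRingEnd ℂ) (Complex.exp (-Complex.I * (x : ℂ) * z)) -
          ∑ j, α j * (Real.exp (-(κ j * x)) : ℂ) := by
      have := hpair _ _ (gram_mulVec_coeffC κ x h)
      simp only [E, perturbE, map_add, map_sum, map_mul, Complex.conj_ofReal, conj_evaluator]
      rw [hβ] at this
      simp only at this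
      rw [← this]
      simp only [Complex.ofReal_neg, mul_neg, Finset.sum_neg_distrib]
      ring
    have hB : (starRingEnd ℂ) (F κ x z) =
        (-1) ^ n * ((starRingEnd ℂ) (Complex.exp (Complex.I * (x : ℂ) * z)) -
          ∑ j, α j * (Real.exp (κ j * x) : ℂ)) := by
      have := hpair _ _ (gram_mulVec_coeffD κ x h)
      simp only [F, perturbF, map_add, map_sum, map_mul, Complex.conj_ofReal, conj_evaluator,
        map_pow, map_neg, map_one]
      rw [hβ] at this
      simp only at this
      rw [← this, mul_sub, Finset.mul_sum]
      simp only [Complex.ofReal_neg, Complex.ofReal_mul, Complex.ofReal_pow, Complex.ofReal_one,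
        mul_neg, Finset.sum_neg_distrib]
      rw [sub_eq_add_neg]
      congr 2
      exact Finset.sum_congr rfl fun j _ => by ring
    have hsq : ((-1 : ℂ) ^ n) * (-1) ^ n = 1 := by rw [← mul_pow]; simp
    have expand : ∀ w : ℂ, Complex.I * ((starRingEnd ℂ) z - w) *
        (evaluator x z w - ∑ j, α j * evaluator x (zero κ j) w) =
        (starRingEnd ℂ) (E κ x z) * Complex.exp (-Complex.I * (x : ℂ) * w) +
        (-(starRingEnd ℂ) (F κ x z)) * ((-1) ^ n * Complex.exp (Complex.I * (x : ℂ) * w)) +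
        ∑ j, (-(α j * (Complex.I * (starRingEnd ℂ) z + κ j))) * evaluator x (zero κ j) w := by
      intro w
      rw [hA, hB, mul_sub, mul_evaluator, Finset.mul_sum]
      have hterm : ∀ j, Complex.I * ((starRingEnd ℂ) z - w) *
          (α j * evaluator x (zero κ j) w) =
          (α j * (Complex.I * (starRingEnd ℂ) z + κ j)) * evaluator x (zero κ j) w +
          α j * (Real.exp (-(κ j * x)) : ℂ) * Complex.exp (-Complex.I * (x : ℂ) * w) -
          α j * (Real.exp (κ j * x) : ℂ) * Complex.exp (Complex.I * (x : ℂ) * w) := by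
        intro j
        linear_combination α j * mul_evaluator_zero κ x j w
      rw [Finset.sum_congr rfl fun j _ => hterm j]
      simp only [Finset.sum_add_distrib, Finset.sum_sub_distrib, neg_mul, Finset.sum_neg_distrib,
        ← Finset.sum_mul]
      linear_combination (-((starRingEnd ℂ) (Complex.exp (Complex.I * (x : ℂ) * z)) -
          ∑ j, α j * (Real.exp (κ j * x) : ℂ)) * Complex.exp (Complex.I * (x : ℂ) * w)) * -hsq
    rw [expand w, eq_combination_E_F h _ _ _ (fun i => by rw [← expand, hkz, mul_zero])]
    ring

end PWZeros

namespace PWZeros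

/-! ### Differentiation with respect to the length of the interval -/

theorem hasDerivAt_integral_neg_self {V : Type*} [NormedAddCommGroup V] [NormedSpace ℝ V]
    [CompleteSpace V] {f : ℝ → V} (hf : Continuous f) (x : ℝ) :
    HasDerivAt (fun s : ℝ => ∫ y in (-s)..s, f y) (f x + f (-x)) x := by
  have h1 : ∀ s : ℝ, HasDerivAt (fun u : ℝ => ∫ y in (0 : ℝ)..u, f y) (f s) s := fun s =>
    intervalIntegral.integral_hasDerivAt_right (hf.intervalIntegrable _ _)
      hf.aestronglyMeasurable.stronglyMeasurableAtFilter hf.continuousAt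
  have h2 : HasDerivAt (fun s : ℝ => ∫ y in (0 : ℝ)..(-s), f y) (-f (-x)) x := by
    exact ((h1 (-x)).scomp x (hasDerivAt_neg x)).congr_deriv (by simp)
  have h3 := (h1 x).sub h2
  rw [sub_neg_eq_add] at h3
  refine h3.congr_of_eventuallyEq (Filter.Eventually.of_forall fun s => ?_)
  exact (intervalIntegral.integral_interval_sub_left (hf.intervalIntegrable _ _)
    (hf.intervalIntegrable _ _)).symm

theorem integral_exp_mul (k x : ℝ) :
    k * ∫ y in (-x)..x, Real.exp (k * y) = Real.exp (k * x) - Real.exp (-(k * x)) := by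
  rw [← intervalIntegral.integral_const_mul]
  have := intervalIntegral.integral_eq_sub_of_hasDerivAt (a := -x) (b := x)
    (f := fun y : ℝ => Real.exp (k * y)) (f' := fun y => k * Real.exp (k * y)) ?_
    (Continuous.intervalIntegrable (by fun_prop) _ _)
  · rw [this, mul_neg]
  · intro y _
    have h1 : HasDerivAt (fun y : ℝ => k * y) k y := by
      simpa using (hasDerivAt_id y).const_mul k
    exact h1.exp.congr_deriv (mul_comm _ _)

theorem hasDerivAt_gram {n : ℕ} (κ : Fin n → ℝ) (x : ℝ) (i j : Fin n) :
    HasDerivAt (fun s => gram κ s i j)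
      (Real.exp (κ i * x) * Real.exp (κ j * x) +
        Real.exp (-(κ i * x)) * Real.exp (-(κ j * x))) x := by
  have h := hasDerivAt_integral_neg_self (f := fun y => Real.exp ((κ i + κ j) * y))
    (by fun_prop) x
  refine h.congr_deriv ?_
  rw [← Real.exp_add, ← Real.exp_add]
  congr 2 <;> ring

/-- These are the two rank-one matrices of `hasDerivAt_gram` with one sign changed; comparing the
two identities produces the differential system of the coefficients. -/
theorem add_mul_gram {n : ℕ} (κ : Fin n → ℝ) (x : ℝ) (i j : Fin n) :
    (κ i + κ j) * gram κ x i j = Real.exp (κ i * x) * Real.exp (κ j * x) -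
      Real.exp (-(κ i * x)) * Real.exp (-(κ j * x)) := by
  rw [gram, Matrix.of_apply, integral_exp_mul, ← Real.exp_add, ← Real.exp_add]
  congr 2 <;> ring

theorem hasDerivAt_exp_mul (k x : ℝ) :
    HasDerivAt (fun s => Real.exp (k * s)) (k * Real.exp (k * x)) x := by
  have h1 : HasDerivAt (fun y : ℝ => k * y) k x := by
    simpa using (hasDerivAt_id x).const_mul k
  exact h1.exp.congr_deriv (mul_comm _ _)

theorem hasDerivAt_exp_neg_mul (k x : ℝ) :
    HasDerivAt (fun s => Real.exp (-(k * s))) (-(k * Real.exp (-(k * x)))) x := by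
  simpa only [neg_mul] using hasDerivAt_exp_mul (-k) x

theorem differentiableAt_det {n : ℕ} {M : ℝ → Matrix (Fin n) (Fin n) ℝ} {x : ℝ}
    (hM : ∀ i j, DifferentiableAt ℝ (fun s => M s i j) x) :
    DifferentiableAt ℝ (fun s => (M s).det) x := by
  simp only [Matrix.det_apply]
  refine DifferentiableAt.fun_sum fun σ _ => ?_
  refine DifferentiableAt.fun_const_smul ?_ _
  exact DifferentiableAt.fun_finsetProd fun i _ => hM _ _

/-- By Cramer's rule each component is a quotient of determinants. -/
theorem differentiableAt_inv_mulVec {n : ℕ} {M : ℝ → Matrix (Fin n) (Fin n) ℝ}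
    {v : ℝ → Fin n → ℝ} {x : ℝ} (hM : ∀ i j, DifferentiableAt ℝ (fun s => M s i j) x)
    (hv : ∀ i, DifferentiableAt ℝ (fun s => v s i) x) (h : IsUnit (M x).det) (j : Fin n) :
    DifferentiableAt ℝ (fun s => (M s)⁻¹.mulVec (v s) j) x := by
  have : (fun s => (M s)⁻¹.mulVec (v s) j) =
      fun s => ((M s).det)⁻¹ * ((M s).updateCol j (v s)).det := by
    funext s
    rw [Matrix.inv_def, Matrix.smul_mulVec, ← Matrix.cramer_eq_adjugate_mulVec, Pi.smul_apply,
      Matrix.cramer_apply, Ring.inverse_eq_inv', smul_eq_mul]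
  rw [this]
  refine ((differentiableAt_det hM).fun_inv h.ne_zero).fun_mul (differentiableAt_det fun i k => ?_)
  by_cases hk : k = j
  · subst hk
    simpa using hv i
  · simpa [Matrix.updateCol_ne hk] using hM i k

/-- The coefficient of the Krein system, in terms of the coefficients `c_j`. -/
noncomputable def muCoeff {n : ℕ} (κ : Fin n → ℝ) (x : ℝ) : ℝ :=
  2 * (-1) ^ n * ∑ j, Real.exp (κ j * x) * coeffC κ x j

/-- Symmetry of the Gram matrix: d · Gc = c · Gd. It lets the same μ serve in both equations of each
system. -/
theorem muCoeff_eq {n : ℕ} {κ : Fin n → ℝ} {x : ℝ} (h : IsUnit (gram κ x).det) :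
    muCoeff κ x = 2 * ∑ j, Real.exp (-(κ j * x)) * coeffD κ x j := by
  have h1 : coeffD κ x ⬝ᵥ (gram κ x).mulVec (coeffC κ x) =
      coeffC κ x ⬝ᵥ (gram κ x).mulVec (coeffD κ x) := by
    rw [Matrix.dotProduct_mulVec, ← Matrix.mulVec_transpose, gram_isSymm, dotProduct_comm]
  rw [gram_mulVec_coeffC κ x h, gram_mulVec_coeffD κ x h] at h1
  simp only [dotProduct, mul_neg, Finset.sum_neg_distrib, neg_inj] at h1
  rw [muCoeff, mul_assoc, Finset.mul_sum]
  congr 1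
  rw [Finset.sum_congr rfl fun j _ => mul_comm (Real.exp (-(κ j * x))) (coeffD κ x j), h1]
  exact Finset.sum_congr rfl fun j _ => by ring

theorem differentiableAt_coeffC {n : ℕ} {κ : Fin n → ℝ} {x : ℝ} (h : IsUnit (gram κ x).det)
    (j : Fin n) : DifferentiableAt ℝ (fun s => coeffC κ s j) x :=
  differentiableAt_inv_mulVec (fun i j => (hasDerivAt_gram κ x i j).differentiableAt)
    (fun i => (hasDerivAt_exp_neg_mul (κ i) x).differentiableAt.fun_neg) h j

theorem differentiableAt_coeffD {n : ℕ} {κ : Fin n → ℝ} {x : ℝ} (h : IsUnit (gram κ x).det)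
    (j : Fin n) : DifferentiableAt ℝ (fun s => coeffD κ s j) x :=
  differentiableAt_inv_mulVec (fun i j => (hasDerivAt_gram κ x i j).differentiableAt)
    (fun i => ((hasDerivAt_exp_mul (κ i) x).differentiableAt.const_mul _).fun_neg) h j

/-- The derivative of `gram κ s *ᵥ v s`. -/
theorem hasDerivAt_gram_mulVec {n : ℕ} (κ : Fin n → ℝ) {v : ℝ → Fin n → ℝ} {v' : Fin n → ℝ}
    {x : ℝ} (hv : ∀ j, HasDerivAt (fun s => v s j) (v' j) x) (i : Fin n) :
    HasDerivAt (fun s => (gram κ s).mulVec (v s) i)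
      (Real.exp (κ i * x) * ∑ j, Real.exp (κ j * x) * v x j +
        Real.exp (-(κ i * x)) * ∑ j, Real.exp (-(κ j * x)) * v x j +
        (gram κ x).mulVec v' i) x := by
  have h := HasDerivAt.fun_sum (u := Finset.univ) fun j _ => (hasDerivAt_gram κ x i j).fun_mul (hv j)
  refine h.congr_deriv ?_
  rw [Finset.mul_sum, Finset.mul_sum, Matrix.mulVec, dotProduct, ← Finset.sum_add_distrib,
    ← Finset.sum_add_distrib]
  exact Finset.sum_congr rfl fun j _ => by ring

theorem gram_mulVec_mul {n : ℕ} (κ : Fin n → ℝ) (x : ℝ) (v : Fin n → ℝ) (i : Fin n) :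
    (gram κ x).mulVec (fun j => κ j * v j) i =
      Real.exp (κ i * x) * ∑ j, Real.exp (κ j * x) * v j -
        Real.exp (-(κ i * x)) * ∑ j, Real.exp (-(κ j * x)) * v j -
        κ i * (gram κ x).mulVec v i := by
  simp only [Matrix.mulVec, dotProduct, Finset.mul_sum, ← Finset.sum_sub_distrib]
  refine Finset.sum_congr rfl fun j _ => ?_
  linear_combination v j * add_mul_gram κ x i j

/-- Differentiating Gc = -e^{-κx} and subtracting G(κc) cancels the terms in e^{-κ_i x}. What
remains is -2 e^{κ_i x} ∑ e^{κ_j x} c_j, a multiple of Gd, so c' - κc is that multiple of d. -/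
theorem hasDerivAt_coeffC {n : ℕ} {κ : Fin n → ℝ} (h : ∀ x, 0 < x → IsUnit (gram κ x).det)
    {x : ℝ} (hx : 0 < x) (j : Fin n) :
    HasDerivAt (fun s => coeffC κ s j) (κ j * coeffC κ x j + muCoeff κ x * coeffD κ x j) x := by
  have hd := fun j => (differentiableAt_coeffC (h x hx) j).hasDerivAt
  set c' : Fin n → ℝ := fun j => deriv (fun s => coeffC κ s j) x with hc'
  suffices hs : c' = fun j => κ j * coeffC κ x j + muCoeff κ x * coeffD κ x j by
    have := hd j
    rwa [show deriv (fun s => coeffC κ s j) x = _ from congrFun hs j] at this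
  apply gram_mulVec_injective (h x hx)
  funext i
  have h1 := hasDerivAt_gram_mulVec κ hd i
  have h2 : HasDerivAt (fun s => (gram κ s).mulVec (coeffC κ s) i)
      (κ i * Real.exp (-(κ i * x))) x := by
    have h3 := (hasDerivAt_exp_neg_mul (κ i) x).fun_neg
    rw [neg_neg] at h3
    refine h3.congr_of_eventuallyEq ?_
    filter_upwards [lt_mem_nhds hx] with s hs
    rw [gram_mulVec_coeffC κ s (h s hs)]
  have h4 := h1.unique h2
  have h5 := gram_mulVec_mul κ x (coeffC κ x) i
  have e1 := congrFun (gram_mulVec_coeffC κ x (h x hx)) i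
  have e2 := congrFun (gram_mulVec_coeffD κ x (h x hx)) i
  have h6 : (gram κ x).mulVec (fun j => κ j * coeffC κ x j + muCoeff κ x * coeffD κ x j) i =
      (gram κ x).mulVec (fun j => κ j * coeffC κ x j) i +
        muCoeff κ x * (gram κ x).mulVec (coeffD κ x) i := by
    rw [show (fun j => κ j * coeffC κ x j + muCoeff κ x * coeffD κ x j) =
      (fun j => κ j * coeffC κ x j) + muCoeff κ x • coeffD κ x from rfl, Matrix.mulVec_add,
      Matrix.mulVec_smul]
    rfl
  have hsq : ((-1 : ℝ) ^ n) * (-1) ^ n = 1 := by rw [← mul_pow]; simp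
  rw [h6, h5, e2, e1, muCoeff]
  linear_combination h4 + 2 * Real.exp (κ i * x) *
    (∑ j, Real.exp (κ j * x) * coeffC κ x j) * hsq

/-- Here G(d' + κd) is a multiple of e^{-κ_i x}, hence of Gc; the multiple is the second form of μ
in `muCoeff_eq`. -/
theorem hasDerivAt_coeffD {n : ℕ} {κ : Fin n → ℝ} (h : ∀ x, 0 < x → IsUnit (gram κ x).det)
    {x : ℝ} (hx : 0 < x) (j : Fin n) :
    HasDerivAt (fun s => coeffD κ s j) (-(κ j * coeffD κ x j) + muCoeff κ x * coeffC κ x j) x := by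
  have hd := fun j => (differentiableAt_coeffD (h x hx) j).hasDerivAt
  set d' : Fin n → ℝ := fun j => deriv (fun s => coeffD κ s j) x with hd'
  suffices hs : d' = fun j => -(κ j * coeffD κ x j) + muCoeff κ x * coeffC κ x j by
    have := hd j
    rwa [show deriv (fun s => coeffD κ s j) x = _ from congrFun hs j] at this
  apply gram_mulVec_injective (h x hx)
  funext i
  have h1 := hasDerivAt_gram_mulVec κ hd i
  have h2 : HasDerivAt (fun s => (gram κ s).mulVec (coeffD κ s) i)
      (-((-1) ^ n * (κ i * Real.exp (κ i * x)))) x := by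
    refine ((hasDerivAt_exp_mul (κ i) x).const_mul ((-1) ^ n)).fun_neg.congr_of_eventuallyEq ?_
    filter_upwards [lt_mem_nhds hx] with s hs
    rw [gram_mulVec_coeffD κ s (h s hs)]
  have h4 := h1.unique h2
  have h5 := gram_mulVec_mul κ x (coeffD κ x) i
  have e1 := congrFun (gram_mulVec_coeffC κ x (h x hx)) i
  have e2 := congrFun (gram_mulVec_coeffD κ x (h x hx)) i
  have h6 : (gram κ x).mulVec (fun j => -(κ j * coeffD κ x j) + muCoeff κ x * coeffC κ x j) i =
      -(gram κ x).mulVec (fun j => κ j * coeffD κ x j) i +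
        muCoeff κ x * (gram κ x).mulVec (coeffC κ x) i := by
    rw [show (fun j => -(κ j * coeffD κ x j) + muCoeff κ x * coeffC κ x j) =
      -(fun j => κ j * coeffD κ x j) + muCoeff κ x • coeffC κ x from rfl, Matrix.mulVec_add,
      Matrix.mulVec_smul, Matrix.mulVec_neg]
    rfl
  rw [h6, h5, e2, e1, muCoeff_eq (h x hx)]
  linear_combination h4

theorem hasDerivAt_evaluator_zero {n : ℕ} (κ : Fin n → ℝ) (x : ℝ) (j : Fin n) (w : ℂ) :
    HasDerivAt (fun s => evaluator s (zero κ j) w)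
      ((Real.exp (κ j * x) : ℂ) * Complex.exp (Complex.I * (x : ℂ) * w) +
        (Real.exp (-(κ j * x)) : ℂ) * Complex.exp (-Complex.I * (x : ℂ) * w)) x := by
  simp only [evaluator_zero_eq]
  refine (hasDerivAt_integral_neg_self (f := fun y : ℝ =>
    Complex.exp ((Complex.I * w + κ j) * (y : ℂ))) (by fun_prop) x).congr_deriv ?_
  push_cast
  rw [← Complex.exp_add, ← Complex.exp_add]
  congr 2 <;> ring

theorem hasDerivAt_cexp_ofReal_mul (k w : ℂ) (x : ℝ) :
    HasDerivAt (fun s : ℝ => Complex.exp (k * (s : ℂ) * w))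
      (k * w * Complex.exp (k * (x : ℂ) * w)) x := by
  have h1 : HasDerivAt (fun y : ℝ => k * (y : ℂ) * w) (k * w) x := by
    simpa using ((Complex.ofRealCLM.hasDerivAt (x := x)).const_mul k).mul_const w
  exact h1.cexp.congr_deriv (mul_comm _ _)

/-- Trading κ_j for -iw by `mul_evaluator_zero` cancels the e^{-ixw} terms of the sum and doubles
the e^{ixw} terms, which add up to μ (-1)^n e^{ixw}, the part of μF not yet accounted for. -/
theorem hasDerivAt_E {n : ℕ} {κ : Fin n → ℝ} (h : ∀ x, 0 < x → IsUnit (gram κ x).det)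
    {x : ℝ} (hx : 0 < x) (w : ℂ) :
    HasDerivAt (fun s : ℝ => E κ s w)
      (-Complex.I * w * E κ x w + (muCoeff κ x : ℂ) * F κ x w) x := by
  have h1 := (hasDerivAt_cexp_ofReal_mul (-Complex.I) w x).fun_add
    (HasDerivAt.fun_sum (u := Finset.univ) fun j _ =>
      (hasDerivAt_coeffC h hx j).ofReal_comp.fun_mul (hasDerivAt_evaluator_zero κ x j w))
  refine h1.congr_deriv ?_
  have hsq : ((-1 : ℂ) ^ n) * (-1) ^ n = 1 := by rw [← mul_pow]; simp
  have hmu : (muCoeff κ x : ℂ) * (-1) ^ n =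
      2 * ∑ j, (Real.exp (κ j * x) : ℂ) * (coeffC κ x j : ℂ) := by
    rw [muCoeff]
    push_cast
    linear_combination 2 * (∑ j, Complex.exp (κ j * x) * (coeffC κ x j : ℂ)) * hsq
  have hterm : ∀ j, (↑(κ j * coeffC κ x j + muCoeff κ x * coeffD κ x j) : ℂ) *
        evaluator x (zero κ j) w + (coeffC κ x j : ℂ) *
        ((Real.exp (κ j * x) : ℂ) * Complex.exp (Complex.I * (x : ℂ) * w) +
        (Real.exp (-(κ j * x)) : ℂ) * Complex.exp (-Complex.I * (x : ℂ) * w)) =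
      (-Complex.I * w) * ((coeffC κ x j : ℂ) * evaluator x (zero κ j) w) +
      (muCoeff κ x : ℂ) * ((coeffD κ x j : ℂ) * evaluator x (zero κ j) w) +
      2 * ((Real.exp (κ j * x) : ℂ) * (coeffC κ x j : ℂ)) *
        Complex.exp (Complex.I * (x : ℂ) * w) := by
    intro j
    rw [Complex.ofReal_add, Complex.ofReal_mul, Complex.ofReal_mul]
    linear_combination -(coeffC κ x j : ℂ) * mul_evaluator_zero κ x j w
  rw [Finset.sum_congr rfl fun j _ => hterm j]
  simp only [Finset.sum_add_distrib, ← Finset.mul_sum, ← Finset.sum_mul]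
  rw [E, F, perturbE, perturbF]
  linear_combination -Complex.exp (Complex.I * (x : ℂ) * w) * hmu

theorem hasDerivAt_F {n : ℕ} {κ : Fin n → ℝ} (h : ∀ x, 0 < x → IsUnit (gram κ x).det)
    {x : ℝ} (hx : 0 < x) (w : ℂ) :
    HasDerivAt (fun s : ℝ => F κ s w)
      (Complex.I * w * F κ x w + (muCoeff κ x : ℂ) * E κ x w) x := by
  have h1 := ((hasDerivAt_cexp_ofReal_mul Complex.I w x).const_mul ((-1) ^ n)).fun_add
    (HasDerivAt.fun_sum (u := Finset.univ) fun j _ =>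
      (hasDerivAt_coeffD h hx j).ofReal_comp.fun_mul (hasDerivAt_evaluator_zero κ x j w))
  refine h1.congr_deriv ?_
  have hmu : (muCoeff κ x : ℂ) =
      2 * ∑ j, (Real.exp (-(κ j * x)) : ℂ) * (coeffD κ x j : ℂ) := by
    rw [muCoeff_eq (h x hx)]
    push_cast
    rfl
  have hterm : ∀ j, (↑(-(κ j * coeffD κ x j) + muCoeff κ x * coeffC κ x j) : ℂ) *
        evaluator x (zero κ j) w + (coeffD κ x j : ℂ) *
        ((Real.exp (κ j * x) : ℂ) * Complex.exp (Complex.I * (x : ℂ) * w) +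
        (Real.exp (-(κ j * x)) : ℂ) * Complex.exp (-Complex.I * (x : ℂ) * w)) =
      (Complex.I * w) * ((coeffD κ x j : ℂ) * evaluator x (zero κ j) w) +
      (muCoeff κ x : ℂ) * ((coeffC κ x j : ℂ) * evaluator x (zero κ j) w) +
      2 * ((Real.exp (-(κ j * x)) : ℂ) * (coeffD κ x j : ℂ)) *
        Complex.exp (-Complex.I * (x : ℂ) * w) := by
    intro j
    rw [Complex.ofReal_add, Complex.ofReal_neg, Complex.ofReal_mul, Complex.ofReal_mul]
    linear_combination (coeffD κ x j : ℂ) * mul_evaluator_zero κ x j w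
  rw [Finset.sum_congr rfl fun j _ => hterm j]
  simp only [Finset.sum_add_distrib, ← Finset.mul_sum, ← Finset.sum_mul]
  rw [E, F, perturbE, perturbF]
  linear_combination -Complex.exp (-Complex.I * (x : ℂ) * w) * hmu

/-- The mu-function is given by `muCoeff`, provided `F` has no zero common to all `w`. -/
theorem isMuFunction_iff {n : ℕ} {κ : Fin n → ℝ} (h : ∀ x, 0 < x → IsUnit (gram κ x).det)
    (hF : ∀ x, 0 < x → ∃ w, F κ x w ≠ 0) (μ : ℝ → ℝ) :
    IsMuFunction κ μ ↔ ∀ a ∈ Set.Ioo (0 : ℝ) 1, μ a = muCoeff κ (-Real.log a) := by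
  constructor
  · intro hμ a ha
    have hx : 0 < -Real.log a := neg_pos.2 (Real.log_neg ha.1 ha.2)
    obtain ⟨w, hw⟩ := hF _ hx
    have h1 := (hμ _ hx w).1.unique (hasDerivAt_E h hx w)
    rw [neg_neg, Real.exp_log ha.1] at h1
    exact_mod_cast mul_right_cancel₀ hw (add_left_cancel h1)
  · intro hμ x hx w
    have hmem : Real.exp (-x) ∈ Set.Ioo (0 : ℝ) 1 :=
      ⟨Real.exp_pos _, Real.exp_lt_one_iff.2 (neg_neg_of_pos hx)⟩
    rw [hμ _ hmem, Real.log_exp, neg_neg]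
    exact ⟨hasDerivAt_E h hx w, hasDerivAt_F h hx w⟩

end PWZeros

namespace PowerWeight

open Polynomial

/-! ### Orthogonal polynomials for the weight `u ^ ν` on `[a, b]` -/

/-- The moment functional `p ↦ ∫_a^b p(u) u^ν du`. -/
noncomputable def moment (a b ν : ℝ) (p : ℝ[X]) : ℝ :=
  ∫ u in a..b, p.eval u * u ^ ν

variable {a b ν : ℝ}

theorem continuousOn_weight (ha : 0 < a) (hab : a < b) (ν : ℝ) (p : ℝ[X]) :
    ContinuousOn (fun u : ℝ => p.eval u * u ^ ν) (Set.uIcc a b) := by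
  refine p.continuous.continuousOn.mul fun u hu => ?_
  rw [Set.uIcc_of_le hab.le] at hu
  exact (Real.continuousAt_rpow_const u ν (Or.inl (ha.trans_le hu.1).ne')).continuousWithinAt

theorem intervalIntegrable_weight (ha : 0 < a) (hab : a < b) (ν : ℝ) (p : ℝ[X]) :
    IntervalIntegrable (fun u : ℝ => p.eval u * u ^ ν) volume a b :=
  (continuousOn_weight ha hab ν p).intervalIntegrable

theorem moment_add (ha : 0 < a) (hab : a < b) (p q : ℝ[X]) :
    moment a b ν (p + q) = moment a b ν p + moment a b ν q := by
  simp only [moment, eval_add, add_mul]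
  exact intervalIntegral.integral_add (intervalIntegrable_weight ha hab ν p)
    (intervalIntegrable_weight ha hab ν q)

theorem moment_C_mul (r : ℝ) (p : ℝ[X]) : moment a b ν (C r * p) = r * moment a b ν p := by
  simp only [moment, eval_mul, eval_C, mul_assoc]
  exact intervalIntegral.integral_const_mul _ _

theorem moment_sub (ha : 0 < a) (hab : a < b) (p q : ℝ[X]) :
    moment a b ν (p - q) = moment a b ν p - moment a b ν q := by
  rw [show p - q = p + C (-1) * q by simp [sub_eq_add_neg], moment_add ha hab, moment_C_mul]
  ring

theorem moment_zero : moment a b ν 0 = 0 := by simp [moment]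

theorem moment_sum (ha : 0 < a) (hab : a < b) {ι : Type*} (s : Finset ι) (p : ι → ℝ[X]) :
    moment a b ν (∑ i ∈ s, p i) = ∑ i ∈ s, moment a b ν (p i) := by
  classical
  induction s using Finset.induction_on with
  | empty => simp [moment_zero]
  | insert i s hi ih => rw [Finset.sum_insert hi, Finset.sum_insert hi, moment_add ha hab, ih]

theorem moment_X_mul (ha : 0 < a) (hab : a < b) (p : ℝ[X]) :
    moment a b ν (X * p) = moment a b (ν + 1) p := by
  refine intervalIntegral.integral_congr fun u hu => ?_
  rw [Set.uIcc_of_le hab.le] at hu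
  simp only [eval_mul, eval_X, Real.rpow_add_one (ha.trans_le hu.1).ne']
  ring

theorem moment_pos (ha : 0 < a) (hab : a < b) {p : ℝ[X]} (hp : p ≠ 0)
    (hnn : ∀ u ∈ Set.Icc a b, 0 ≤ p.eval u) : 0 < moment a b ν p := by
  obtain ⟨u, hu, hpu⟩ : ∃ u ∈ Set.Icc a b, p.eval u ≠ 0 := by
    by_contra! hcon
    exact hp (p.eq_zero_of_infinite_isRoot ((Set.Icc_infinite hab).mono fun u hu => hcon u hu))
  refine intervalIntegral.integral_pos hab ?_ (fun u hu => ?_) ⟨u, hu, ?_⟩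
  · rw [← Set.uIcc_of_le hab.le]
    exact continuousOn_weight ha hab ν p
  · exact mul_nonneg (hnn u (Set.Ioc_subset_Icc_self hu)) (Real.rpow_nonneg (ha.trans hu.1).le _)
  · exact mul_pos ((hnn u hu).lt_of_ne' hpu) (Real.rpow_pos_of_pos (ha.trans_le hu.1) _)

theorem moment_mul_self_pos (ha : 0 < a) (hab : a < b) {p : ℝ[X]} (hp : p ≠ 0) :
    0 < moment a b ν (p * p) :=
  moment_pos ha hab (mul_ne_zero hp hp) fun u _ => by
    rw [eval_mul]
    exact mul_self_nonneg _

/-- Integration by parts. -/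
theorem moment_boundary (ha : 0 < a) (hab : a < b) (p : ℝ[X]) :
    b ^ (ν + 1) * p.eval b - a ^ (ν + 1) * p.eval a =
      (ν + 1) * moment a b ν p + moment a b ν (X * derivative p) := by
  have key := intervalIntegral.integral_eq_sub_of_hasDerivAt (a := a) (b := b)
    (f := fun u : ℝ => u ^ (ν + 1) * p.eval u)
    (f' := fun u => (C (ν + 1) * p + X * derivative p).eval u * u ^ ν) ?_
    (intervalIntegrable_weight ha hab ν _)
  · rw [← key, ← moment_C_mul, ← moment_add ha hab]
    rfl
  · intro u hu
    rw [Set.uIcc_of_le hab.le] at hu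
    have hu0 : u ≠ 0 := (ha.trans_le hu.1).ne'
    refine ((Real.hasDerivAt_rpow_const (p := ν + 1) (Or.inl hu0)).mul
      (p.hasDerivAt u)).congr_deriv ?_
    rw [add_sub_cancel_right, Real.rpow_add_one hu0]
    simp only [eval_add, eval_mul, eval_C, eval_X]
    ring

/-! #### Polynomials of bounded degree -/

/-- The polynomial with coefficients `v`. -/
noncomputable def ofVec {n : ℕ} (v : Fin n → ℝ) : ℝ[X] :=
  ∑ j : Fin n, C (v j) * X ^ (j : ℕ)

theorem degree_ofVec {n : ℕ} (v : Fin n → ℝ) : (ofVec v).degree < n :=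
  degree_sum_fin_lt v

theorem coeff_ofVec {n : ℕ} (v : Fin n → ℝ) (i : Fin n) : (ofVec v).coeff i = v i := by
  simp [ofVec, coeff_X_pow, ← Fin.ext_iff]

theorem ofVec_coeff {n : ℕ} {q : ℝ[X]} (hq : q.degree < n) :
    ofVec (fun j : Fin n => q.coeff j) = q := by
  ext i
  by_cases hi : i < n
  · exact coeff_ofVec _ ⟨i, hi⟩
  · have hni : (n : WithBot ℕ) ≤ i := by exact_mod_cast not_lt.1 hi
    rw [coeff_eq_zero_of_degree_lt ((degree_ofVec _).trans_le hni),
      coeff_eq_zero_of_degree_lt (hq.trans_le hni)]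

theorem moment_mul_ofVec (ha : 0 < a) (hab : a < b) {n : ℕ} (p : ℝ[X]) (v : Fin n → ℝ) :
    moment a b ν (p * ofVec v) = ∑ j, v j * moment a b ν (p * X ^ (j : ℕ)) := by
  rw [ofVec, Finset.mul_sum, moment_sum ha hab]
  refine Finset.sum_congr rfl fun j _ => ?_
  rw [← moment_C_mul]
  congr 1
  ring

theorem moment_mul_eq_zero (ha : 0 < a) (hab : a < b) {n : ℕ} {p : ℝ[X]}
    (hp : ∀ i : Fin n, moment a b ν (p * X ^ (i : ℕ)) = 0) {q : ℝ[X]} (hq : q.degree < n) :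
    moment a b ν (p * q) = 0 := by
  rw [← ofVec_coeff hq, moment_mul_ofVec ha hab]
  simp [hp]

/-- The Hankel matrix of the weight. -/
noncomputable def hankel (n : ℕ) (a b ν : ℝ) : Matrix (Fin n) (Fin n) ℝ :=
  Matrix.of fun i j => moment a b ν (X ^ ((i : ℕ) + (j : ℕ)))

theorem hankel_mulVec (ha : 0 < a) (hab : a < b) {n : ℕ} (v : Fin n → ℝ) (i : Fin n) :
    (hankel n a b ν).mulVec v i = moment a b ν (X ^ (i : ℕ) * ofVec v) := by
  rw [moment_mul_ofVec ha hab]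
  simp only [hankel, Matrix.mulVec, dotProduct, Matrix.of_apply, pow_add]
  exact Finset.sum_congr rfl fun j _ => mul_comm _ _

/-- A null vector would be a polynomial of degree less than n orthogonal to itself, against
positivity of the weight. -/
theorem isUnit_det_hankel (ha : 0 < a) (hab : a < b) (n : ℕ) :
    IsUnit (hankel n a b ν).det := by
  rw [isUnit_iff_ne_zero]
  intro hdet
  obtain ⟨v, hv, h0⟩ := Matrix.exists_mulVec_eq_zero_iff.2 hdet
  have h1 : moment a b ν (ofVec v * ofVec v) = 0 := by
    refine moment_mul_eq_zero ha hab (fun i => ?_) (degree_ofVec v)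
    rw [mul_comm, ← hankel_mulVec ha hab, h0]
    rfl
  have h2 : ofVec v = 0 := by
    by_contra hne
    exact (moment_mul_self_pos ha hab hne).ne' h1
  apply hv
  funext i
  rw [← coeff_ofVec v i, h2]
  simp

/-- `p` is the monic orthogonal polynomial of degree `n` for the weight `u ^ ν` on `[a, b]`. -/
structure IsMonicOrthogonal (a b ν : ℝ) (n : ℕ) (p : ℝ[X]) : Prop where
  monic : p.Monic
  natDegree_eq : p.natDegree = n
  orthogonal : ∀ q : ℝ[X], q.degree < n → moment a b ν (p * q) = 0

/-- Subtract from X^n its orthogonal projection on the polynomials of lower degree. -/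
theorem exists_isMonicOrthogonal (ha : 0 < a) (hab : a < b) (ν : ℝ) (n : ℕ) :
    ∃ p, IsMonicOrthogonal a b ν n p := by
  set r : Fin n → ℝ := fun i => moment a b ν (X ^ (i : ℕ) * X ^ n) with hr
  set v : Fin n → ℝ := (hankel n a b ν)⁻¹.mulVec r with hv
  have hHv : (hankel n a b ν).mulVec v = r := by
    rw [hv, Matrix.mulVec_mulVec, Matrix.mul_nonsing_inv _ (isUnit_det_hankel ha hab n),
      Matrix.one_mulVec]
  refine ⟨X ^ n - ofVec v, ?_, ?_, fun q hq => moment_mul_eq_zero ha hab (fun i => ?_) hq⟩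
  · exact monic_X_pow_sub (degree_ofVec v)
  · refine natDegree_eq_of_degree_eq_some ?_
    rw [degree_sub_eq_left_of_degree_lt, degree_X_pow]
    rw [degree_X_pow]
    exact degree_ofVec v
  · have h1 := congrFun hHv i
    rw [hankel_mulVec ha hab] at h1
    rw [mul_comm, mul_sub, moment_sub ha hab, h1, sub_self]

theorem degree_lt_of_X_sub_C_mul {p q : ℝ[X]} {t : ℝ} {m : ℕ} (h : (X - C t) * q = p)
    (hp : p.degree < (m + 1 : ℕ)) : q.degree < m := by
  rcases eq_or_ne q 0 with rfl | hq
  · simp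
  · rw [← h, degree_mul, degree_X_sub_C, degree_eq_natDegree hq] at hp
    rw [degree_eq_natDegree hq]
    have : 1 + q.natDegree < m + 1 := by exact_mod_cast hp
    exact_mod_cast (by omega : q.natDegree < m)

theorem natDegree_le_of_degree_lt_succ {q : ℝ[X]} {m : ℕ} (h : q.degree < (m + 1 : ℕ)) :
    q.natDegree ≤ m := by
  rcases eq_or_ne q 0 with rfl | hq
  · simp
  · rw [degree_eq_natDegree hq] at h
    exact Nat.lt_succ_iff.1 (by exact_mod_cast h)

theorem degree_C_mul_le_degree (r : ℝ) (q : ℝ[X]) : (C r * q).degree ≤ q.degree := by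
  rw [← smul_eq_C_mul]
  exact degree_smul_le r q

/-! ### Zeros, boundary values and reproducing kernels. -/

namespace IsMonicOrthogonal

variable {n m : ℕ} {p P Q : ℝ[X]}

theorem degree_eq (hp : IsMonicOrthogonal a b ν n p) : p.degree = n := by
  rw [degree_eq_natDegree hp.monic.ne_zero, hp.natDegree_eq]

theorem coeff_eq_one (hp : IsMonicOrthogonal a b ν n p) : p.coeff n = 1 := by
  rw [← hp.natDegree_eq]
  exact hp.monic

theorem moment_mul_self_pos (ha : 0 < a) (hab : a < b) (hp : IsMonicOrthogonal a b ν n p) :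
    0 < moment a b ν (p * p) :=
  PowerWeight.moment_mul_self_pos ha hab hp.monic.ne_zero

/-- An orthogonal polynomial has no zero outside the open interval of orthogonality. -/
theorem eval_ne_zero (ha : 0 < a) (hab : a < b) (hp : IsMonicOrthogonal a b ν n p) {r : ℝ}
    (hr : r ≤ a ∨ b ≤ r) : p.eval r ≠ 0 := by
  intro h0
  -- With p = (X - r)q, the product pq = (X - r)q² has constant sign on [a, b], yet its moment
  -- vanishes because q has degree less than n.
  obtain ⟨q, hq⟩ := dvd_iff_isRoot.2 h0
  have hp0 := hp.monic.ne_zero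
  have hq0 : q ≠ 0 := by
    rintro rfl
    exact hp0 (by simpa using hq)
  have hdeg : q.degree < n := degree_lt_of_X_sub_C_mul (t := r) hq.symm (by
    rw [hp.degree_eq]
    exact_mod_cast Nat.lt_succ_self n)
  have h1 := hp.orthogonal q hdeg
  rcases hr with hr | hr
  · refine (moment_pos ha hab (mul_ne_zero hp0 hq0) fun u hu => ?_).ne' h1
    rw [hq]
    simp only [eval_mul, eval_sub, eval_X, eval_C]
    have := mul_nonneg (sub_nonneg.2 (hr.trans hu.1)) (mul_self_nonneg (q.eval u))
    linarith
  · have h2 : moment a b ν (C (-1) * (p * q)) = 0 := by rw [moment_C_mul, h1, mul_zero]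
    refine (moment_pos ha hab (mul_ne_zero (by simp) (mul_ne_zero hp0 hq0)) fun u hu => ?_).ne' h2
    rw [hq]
    simp only [eval_mul, eval_sub, eval_X, eval_C]
    have := mul_nonneg (sub_nonneg.2 (hu.2.trans hr)) (mul_self_nonneg (q.eval u))
    linarith

/-- The scalar product with a polynomial of degree at most `n` only sees its top coefficient. -/
theorem moment_mul_eq_coeff (ha : 0 < a) (hab : a < b) (hp : IsMonicOrthogonal a b ν n p)
    {q : ℝ[X]} (hq : q.natDegree ≤ n) :
    moment a b ν (p * q) = q.coeff n * moment a b ν (p * p) := by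
  have hlt : (q - C (q.coeff n) * p).degree < n := by
    rw [degree_lt_iff_coeff_zero]
    intro k hk
    rcases hk.eq_or_lt with rfl | hk
    · simp [hp.coeff_eq_one]
    · rw [coeff_sub, coeff_C_mul, coeff_eq_zero_of_natDegree_lt (hq.trans_lt hk),
        coeff_eq_zero_of_natDegree_lt (hp.natDegree_eq.trans_lt hk)]
      simp
  have h1 := hp.orthogonal _ hlt
  rw [mul_sub, moment_sub ha hab, mul_left_comm, moment_C_mul] at h1
  linarith

/-- The boundary values of the orthogonal polynomials for `ν` and `ν + 1`. -/
theorem boundary (ha : 0 < a) (hab : a < b) (hP : IsMonicOrthogonal a b ν (m + 1) P)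
    (hQ : IsMonicOrthogonal a b (ν + 1) m Q) :
    b ^ (ν + 1) * (P.eval b * Q.eval b) - a ^ (ν + 1) * (P.eval a * Q.eval a) =
      (m + 1) * moment a b (ν + 1) (Q * Q) := by
  -- The moments of PQ and P·XQ' vanish since P is orthogonal to degrees at most m. In Q·XP' the
  -- factor X raises the weight to u^(ν+1), where Q sees only the top coefficient m + 1 of P'.
  have h := moment_boundary (ν := ν) ha hab (P * Q)
  rw [eval_mul, eval_mul] at h
  have hlt : ∀ {k l : ℕ}, k < l → (k : WithBot ℕ) < l := fun h => by exact_mod_cast h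
  have h1 : moment a b ν (P * Q) = 0 := hP.orthogonal Q (by
    rw [hQ.degree_eq]
    exact hlt (Nat.lt_succ_self m))
  have h2 : moment a b ν (P * (X * derivative Q)) = 0 := by
    refine hP.orthogonal _ ?_
    rw [mul_comm, degree_lt_iff_coeff_zero]
    rintro (_ | k) hk
    · simp at hk
    · rw [coeff_mul_X, coeff_derivative, coeff_eq_zero_of_natDegree_lt, zero_mul]
      rw [hQ.natDegree_eq]
      exact hk
  have h3 : moment a b ν (X * (Q * derivative P)) = (m + 1) * moment a b (ν + 1) (Q * Q) := by
    rw [moment_X_mul ha hab, hQ.moment_mul_eq_coeff ha hab, coeff_derivative, hP.coeff_eq_one,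
      one_mul]
    refine (natDegree_derivative_le P).trans ?_
    rw [hP.natDegree_eq, Nat.add_sub_cancel]
  rw [h, h1, derivative_mul, show X * (derivative P * Q + P * derivative Q) =
    X * (Q * derivative P) + P * (X * derivative Q) by ring, moment_add ha hab, h2, h3]
  ring

/-- Since q - q(t) is divisible by X - t, integration against S is a multiple of evaluation at t;
only the constant remains to be found. -/
theorem moment_eq_eval_mul (ha : 0 < a) (hab : a < b) {S : ℝ[X]} {t : ℝ}
    (hS : ∀ r : ℝ[X], r.degree < m → moment a b ν ((X - C t) * S * r) = 0)
    {q : ℝ[X]} (hq : q.degree < (m + 1 : ℕ)) :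
    moment a b ν (S * q) = q.eval t * moment a b ν S := by
  have hroot : (q - C (q.eval t)).IsRoot t := by simp
  obtain ⟨r, hr⟩ := dvd_iff_isRoot.2 hroot
  have hdeg : r.degree < m := by
    refine degree_lt_of_X_sub_C_mul hr.symm ?_
    refine (degree_sub_le _ _).trans_lt (max_lt hq (degree_C_le.trans_lt ?_))
    exact_mod_cast Nat.succ_pos m
  have h1 : S * q = C (q.eval t) * S + (X - C t) * S * r := by
    linear_combination S * hr
  rw [h1, moment_add ha hab, hS r hdeg, moment_C_mul, add_zero]

/-- The reproducing kernel for the weight `u ^ ν` at `t`, up to a factor. -/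
theorem exists_kernel (ha : 0 < a) (hab : a < b) (hP : IsMonicOrthogonal a b ν (m + 1) P)
    (hQ : IsMonicOrthogonal a b (ν + 1) m Q) {t : ℝ} (ht : t ≠ 0) (hQt : Q.eval t ≠ 0) :
    ∃ S : ℝ[X], S.degree < (m + 1 : ℕ) ∧
      (X - C t) * S = C (t * Q.eval t) * P - C (P.eval t) * (X * Q) ∧
      ∀ q : ℝ[X], q.degree < (m + 1 : ℕ) →
        moment a b ν (S * q) = moment a b (ν + 1) (Q * Q) * q.eval t := by
  have hroot : (C (t * Q.eval t) * P - C (P.eval t) * (X * Q)).IsRoot t := by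
    simp only [IsRoot, eval_sub, eval_mul, eval_C, eval_X]
    ring
  obtain ⟨S, hS⟩ := dvd_iff_isRoot.2 hroot
  have hXQ : (X * Q).degree = ((m + 1 : ℕ) : WithBot ℕ) := by
    rw [degree_mul, degree_X, hQ.degree_eq, add_comm]
    rfl
  have hQlt : Q.degree < (m + 1 : ℕ) := by
    rw [hQ.degree_eq]
    exact_mod_cast Nat.lt_succ_self m
  have hdeg : S.degree < (m + 1 : ℕ) := by
    refine degree_lt_of_X_sub_C_mul hS.symm ((degree_sub_le _ _).trans_lt (max_lt ?_ ?_))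
    · refine (degree_C_mul_le_degree _ _).trans_lt ?_
      rw [hP.degree_eq]
      exact_mod_cast Nat.lt_succ_self _
    · refine (degree_C_mul_le_degree _ _).trans_lt ?_
      rw [hXQ]
      exact_mod_cast Nat.lt_succ_self _
  -- XQ against u^ν is Q against u^(ν+1), so both terms vanish for r of degree less than m.
  have hexp : ∀ r : ℝ[X], moment a b ν ((X - C t) * S * r) =
      t * Q.eval t * moment a b ν (P * r) - P.eval t * moment a b (ν + 1) (Q * r) := by
    intro r
    rw [← hS, ← moment_X_mul ha hab, ← moment_C_mul, ← moment_C_mul, ← moment_sub ha hab]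
    congr 1
    ring
  have hmul : ∀ q : ℝ[X], q.degree < (m + 1 : ℕ) →
      moment a b ν (S * q) = q.eval t * moment a b ν S := fun q hq =>
    moment_eq_eval_mul ha hab (fun r hr => by
      rw [hexp, hP.orthogonal r (hr.trans (by exact_mod_cast Nat.lt_succ_self m)),
        hQ.orthogonal r hr]
      ring) hq
  have hcoeff : S.coeff m = t * Q.eval t - P.eval t := by
    have h1 := congrArg (fun p => p.coeff (m + 1)) hS
    simp only [coeff_sub, coeff_C_mul, sub_mul, coeff_X_mul, hP.coeff_eq_one, hQ.coeff_eq_one] at h1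
    rw [coeff_eq_zero_of_degree_lt hdeg] at h1
    linarith
  have hSnat : S.natDegree ≤ m := natDegree_le_of_degree_lt_succ hdeg
  -- The constant comes from testing with Q: X(QS) against u^ν is QS against u^(ν+1), which sees
  -- only the top coefficient tQ(t) - P(t) of S.
  have htot : t * Q.eval t * moment a b ν S = t * Q.eval t * moment a b (ν + 1) (Q * Q) := by
    have h1 := hexp Q
    rw [hP.orthogonal Q hQlt, show (X - C t) * S * Q = X * (Q * S) - C t * (S * Q) by ring,
      moment_sub ha hab, moment_X_mul ha hab, moment_C_mul, hQ.moment_mul_eq_coeff ha hab hSnat,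
      hcoeff, hmul Q hQlt] at h1
    linarith
  refine ⟨S, hdeg, hS.symm, fun q hq => ?_⟩
  rw [hmul q hq, mul_left_cancel₀ (mul_ne_zero ht hQt) htot, mul_comm]

/-- The reproducing kernel for the weight `u ^ (ν + 1)` at `t`, up to a factor. -/
theorem exists_kernel_succ (ha : 0 < a) (hab : a < b) (hP : IsMonicOrthogonal a b ν (m + 1) P)
    (hQ : IsMonicOrthogonal a b (ν + 1) m Q) {t : ℝ} (hQt : Q.eval t ≠ 0) :
    ∃ T : ℝ[X], T.degree < (m + 1 : ℕ) ∧
      (X - C t) * T = C (Q.eval t) * P - C (P.eval t) * Q ∧ T.coeff m = Q.eval t ∧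
      ∀ q : ℝ[X], q.degree < (m + 1 : ℕ) →
        moment a b (ν + 1) (T * q) = moment a b (ν + 1) (Q * Q) * q.eval t := by
  have hroot : (C (Q.eval t) * P - C (P.eval t) * Q).IsRoot t := by
    simp only [IsRoot, eval_sub, eval_mul, eval_C]
    ring
  obtain ⟨T, hT⟩ := dvd_iff_isRoot.2 hroot
  have hQlt : Q.degree < (m + 1 : ℕ) := by
    rw [hQ.degree_eq]
    exact_mod_cast Nat.lt_succ_self m
  have hdeg : T.degree < (m + 1 : ℕ) := by
    refine degree_lt_of_X_sub_C_mul hT.symm ((degree_sub_le _ _).trans_lt (max_lt ?_ ?_))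
    · refine (degree_C_mul_le_degree _ _).trans_lt ?_
      rw [hP.degree_eq]
      exact_mod_cast Nat.lt_succ_self _
    · refine (degree_C_mul_le_degree _ _).trans_lt (hQlt.trans ?_)
      exact_mod_cast Nat.lt_succ_self _
  have hmul : ∀ q : ℝ[X], q.degree < (m + 1 : ℕ) →
      moment a b (ν + 1) (T * q) = q.eval t * moment a b (ν + 1) T := fun q hq =>
    moment_eq_eval_mul ha hab (fun r hr => by
      have hXr : (X * r).degree < ((m + 1 : ℕ) : WithBot ℕ) := by
        rcases eq_or_ne r 0 with rfl | hr0
        · simp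
        · rw [degree_mul, degree_X, degree_eq_natDegree hr0]
          rw [degree_eq_natDegree hr0] at hr
          have : r.natDegree < m := by exact_mod_cast hr
          exact_mod_cast (by omega : 1 + r.natDegree < m + 1)
      rw [← hT, show (C (Q.eval t) * P - C (P.eval t) * Q) * r =
        C (Q.eval t) * (P * r) - C (P.eval t) * (Q * r) by ring, moment_sub ha hab, moment_C_mul,
        moment_C_mul, hQ.orthogonal r hr, ← moment_X_mul ha hab, mul_left_comm,
        hP.orthogonal _ hXr]
      ring) hq
  have hcoeff : T.coeff m = Q.eval t := by
    have h1 := congrArg (fun p => p.coeff (m + 1)) hT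
    simp only [coeff_sub, coeff_C_mul, sub_mul, coeff_X_mul, hP.coeff_eq_one] at h1
    rw [coeff_eq_zero_of_degree_lt hdeg, coeff_eq_zero_of_degree_lt hQlt] at h1
    linarith
  have hTnat : T.natDegree ≤ m := natDegree_le_of_degree_lt_succ hdeg
  -- Test with Q, which sees only the top coefficient Q(t) of T.
  have htot : Q.eval t * moment a b (ν + 1) T = Q.eval t * moment a b (ν + 1) (Q * Q) := by
    rw [← hmul Q hQlt, mul_comm T, hQ.moment_mul_eq_coeff ha hab hTnat, hcoeff]
  refine ⟨T, hdeg, hT.symm, hcoeff, fun q hq => ?_⟩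
  rw [hmul q hq, mul_left_cancel₀ hQt htot, mul_comm]

end IsMonicOrthogonal

end PowerWeight

namespace PowerWeight

open Polynomial

/-! ### The Gram matrix of the arithmetic progression -/

theorem exp_mul_neg_log {a : ℝ} (ha : 0 < a) (k : ℝ) (i : ℕ) :
    Real.exp ((k + i) * -Real.log a) = (a ^ k)⁻¹ * a⁻¹ ^ i := by
  rw [mul_neg, Real.exp_neg, mul_comm, Real.exp_mul, Real.exp_log ha, Real.rpow_add_natCast ha.ne',
    mul_inv, inv_pow]

theorem exp_neg_mul_neg_log {a : ℝ} (ha : 0 < a) (k : ℝ) (i : ℕ) :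
    Real.exp (-((k + i) * -Real.log a)) = a ^ k * a ^ i := by
  rw [mul_neg, neg_neg, mul_comm, Real.exp_mul, Real.exp_log ha, Real.rpow_add_natCast ha.ne']

/-- Substitute u = e^y; the Jacobian du = u dy lowers the exponent from ν + 1 to ν. -/
theorem integral_exp_eq_moment {a : ℝ} (ha : 0 < a) (ν : ℝ) (k : ℕ) :
    ∫ y in (-(-Real.log a))..(-Real.log a), Real.exp ((ν + 1 + k) * y) =
      moment a a⁻¹ ν (X ^ k) := by
  have h := intervalIntegral.integral_comp_mul_deriv' (a := -(-Real.log a)) (b := -Real.log a)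
    (f := Real.exp) (f' := Real.exp) (g := fun u => (X ^ k : ℝ[X]).eval u * u ^ ν)
    (fun y _ => Real.hasDerivAt_exp y) Real.continuous_exp.continuousOn ?_
  · rw [neg_neg, Real.exp_neg, Real.exp_log ha] at h
    rw [moment, ← h, neg_neg]
    refine intervalIntegral.integral_congr fun y _ => ?_
    simp only [Function.comp, eval_pow, eval_X]
    rw [← Real.exp_mul, ← Real.exp_nat_mul, ← Real.exp_add, ← Real.exp_add]
    congr 1
    ring
  · rintro _ ⟨y, _, rfl⟩
    exact ((X ^ k : ℝ[X]).continuous.continuousAt.mul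
      (Real.continuousAt_rpow_const _ ν (Or.inl (Real.exp_pos y).ne'))).continuousWithinAt

/-- This is where the arithmetic progression enters: κ_i + κ_j = ν + 1 + i + j depends only on i +
j. -/
theorem gram_kappa {a : ℝ} (ha : 0 < a) (n : ℕ) (ν : ℝ) :
    PWZeros.gram (PWZeros.kappa n ν) (-Real.log a) = hankel n a a⁻¹ ν := by
  ext i j
  rw [PWZeros.gram, hankel, Matrix.of_apply, Matrix.of_apply, ← integral_exp_eq_moment ha]
  congr 1
  funext y
  congr 2
  simp only [PWZeros.kappa]
  push_cast
  ring

theorem lt_inv_self {a : ℝ} (ha : a ∈ Set.Ioo (0 : ℝ) 1) : a < a⁻¹ :=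
  ha.2.trans (one_lt_inv₀ ha.1 |>.2 ha.2)

theorem isUnit_det_gram_kappa (n : ℕ) (ν : ℝ) (x : ℝ) (hx : 0 < x) :
    IsUnit (PWZeros.gram (PWZeros.kappa n ν) x).det := by
  have hmem : Real.exp (-x) ∈ Set.Ioo (0 : ℝ) 1 :=
    ⟨Real.exp_pos _, Real.exp_lt_one_iff.2 (neg_neg_of_pos hx)⟩
  have h := isUnit_det_hankel (ν := ν) hmem.1 (lt_inv_self hmem) n
  rwa [← gram_kappa hmem.1, Real.log_exp, neg_neg] at h

/-! ### The coefficients in terms of reproducing kernels -/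

/-- Up to the factor `h`, `S` is the reproducing kernel at `t` of the polynomials of degree less
than `n`, for the weight `u ^ ν` on `[a, b]`. -/
structure IsKernel (a b ν : ℝ) (n : ℕ) (h t : ℝ) (S : ℝ[X]) : Prop where
  degree_lt : S.degree < n
  moment_mul : ∀ q : ℝ[X], q.degree < n → moment a b ν (S * q) = h * q.eval t

variable {a ν h t : ℝ} {n m : ℕ} {S P Q : ℝ[X]}

theorem IsKernel.hankel_mulVec_coeff {b : ℝ} (ha : 0 < a) (hab : a < b)
    (hS : IsKernel a b ν n h t S) (i : Fin n) :
    (hankel n a b ν).mulVec (fun j => S.coeff j) i = h * t ^ (i : ℕ) := by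
  have hi : (X ^ (i : ℕ) : ℝ[X]).degree < n := by
    rw [degree_X_pow]
    exact_mod_cast i.2
  rw [hankel_mulVec ha hab, ofVec_coeff hS.degree_lt, mul_comm, hS.moment_mul _ hi, eval_pow,
    eval_X]

/-- The right-hand side -e^{-κ_i x} is a constant times a^i, the value at a of the i-th monomial;
for d the point is 1/a. -/
theorem coeffC_eq (ha : a ∈ Set.Ioo (0 : ℝ) 1) (hh : h ≠ 0) (hS : IsKernel a a⁻¹ ν n h a S) :
    PWZeros.coeffC (PWZeros.kappa n ν) (-Real.log a) =
      fun j : Fin n => -(a ^ ((ν + 1) / 2) / h) * S.coeff j := by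
  have hunit := isUnit_det_gram_kappa n ν _ (neg_pos.2 (Real.log_neg ha.1 ha.2))
  apply PWZeros.gram_mulVec_injective hunit
  rw [PWZeros.gram_mulVec_coeffC _ _ hunit, gram_kappa ha.1]
  funext i
  rw [show (fun j : Fin n => -(a ^ ((ν + 1) / 2) / h) * S.coeff j) =
    (-(a ^ ((ν + 1) / 2) / h)) • (fun j : Fin n => S.coeff j) from rfl, Matrix.mulVec_smul,
    Pi.smul_apply, hS.hankel_mulVec_coeff ha.1 (lt_inv_self ha), PWZeros.kappa,
    exp_neg_mul_neg_log ha.1, smul_eq_mul]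
  field_simp

theorem coeffD_eq (ha : a ∈ Set.Ioo (0 : ℝ) 1) (hh : h ≠ 0) (hS : IsKernel a a⁻¹ ν n h a⁻¹ S) :
    PWZeros.coeffD (PWZeros.kappa n ν) (-Real.log a) =
      fun j : Fin n => -((-1) ^ n * (a ^ ((ν + 1) / 2))⁻¹ / h) * S.coeff j := by
  have hunit := isUnit_det_gram_kappa n ν _ (neg_pos.2 (Real.log_neg ha.1 ha.2))
  apply PWZeros.gram_mulVec_injective hunit
  rw [PWZeros.gram_mulVec_coeffD _ _ hunit, gram_kappa ha.1]
  funext i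
  rw [show (fun j : Fin n => -((-1) ^ n * (a ^ ((ν + 1) / 2))⁻¹ / h) * S.coeff j) =
    (-((-1) ^ n * (a ^ ((ν + 1) / 2))⁻¹ / h)) • (fun j : Fin n => S.coeff j) from rfl,
    Matrix.mulVec_smul,
    Pi.smul_apply, hS.hankel_mulVec_coeff ha.1 (lt_inv_self ha), PWZeros.kappa,
    exp_mul_neg_log ha.1, smul_eq_mul]
  field_simp

/-- The weights e^{κ_j x} are a common factor times a^{-j}, so the sum evaluates the kernel at 1/a.
-/
theorem muCoeff_eq_eval (ha : a ∈ Set.Ioo (0 : ℝ) 1) (hh : h ≠ 0)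
    (hS : IsKernel a a⁻¹ ν n h a S) :
    PWZeros.muCoeff (PWZeros.kappa n ν) (-Real.log a) = -(2 * (-1) ^ n * (S.eval a⁻¹ / h)) := by
  have hα : a ^ ((ν + 1) / 2) ≠ 0 := (Real.rpow_pos_of_pos ha.1 _).ne'
  have hev : S.eval a⁻¹ = ∑ j : Fin n, S.coeff j * a⁻¹ ^ (j : ℕ) := by
    conv_lhs => rw [← ofVec_coeff hS.degree_lt]
    simp [ofVec, eval_finsetSum]
  rw [PWZeros.muCoeff, coeffC_eq ha hh hS, hev, Finset.sum_div, Finset.mul_sum, Finset.mul_sum,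
    ← Finset.sum_neg_distrib]
  refine Finset.sum_congr rfl fun j _ => ?_
  rw [PWZeros.kappa, exp_mul_neg_log ha.1]
  field_simp

/-- Used with k = n at the point following the progression, and with k = 0 and the weight lowered by
one at the point preceding it. -/
theorem sum_coeff_mul_integral (ha : a ∈ Set.Ioo (0 : ℝ) 1) (hS : S.degree < n) (r s : ℝ) (k : ℕ)
    (κ : Fin n → ℝ) (hκ : ∀ j, κ j - s = ν + 1 + ((j : ℕ) + k : ℕ)) :
    ∑ j : Fin n, r * S.coeff j *
      ∫ y in (-(-Real.log a))..(-Real.log a), Real.exp ((κ j - s) * y) =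
      r * moment a a⁻¹ ν (X ^ k * S) := by
  conv_rhs => rw [← ofVec_coeff hS, moment_mul_ofVec ha.1 (lt_inv_self ha)]
  rw [Finset.mul_sum]
  refine Finset.sum_congr rfl fun j _ => ?_
  rw [hκ, integral_exp_eq_moment ha.1, ← pow_add, add_comm k, mul_assoc]

/-! ### The values at the next point of the progression -/

/-- X^n - P has degree less than n, so the kernel evaluates it, while P is orthogonal to S. -/
theorem IsKernel.moment_X_pow_mul (ha : 0 < a) {b : ℝ} (hab : a < b)
    (hP : IsMonicOrthogonal a b ν n P) (hS : IsKernel a b ν n h t S) :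
    moment a b ν (X ^ n * S) = h * (t ^ n - P.eval t) := by
  have hdeg : (X ^ n - P).degree < (n : WithBot ℕ) := by
    have h1 := degree_sub_lt_left (p := X ^ n) (q := P) (by rw [degree_X_pow, hP.degree_eq])
      (pow_ne_zero n X_ne_zero) (by rw [leadingCoeff_X_pow, hP.monic.leadingCoeff])
    rwa [degree_X_pow] at h1
  have h2 := hS.moment_mul _ hdeg
  rw [show X ^ n * S = S * (X ^ n - P) + P * S by ring, moment_add ha hab, h2,
    hP.orthogonal S hS.degree_lt, eval_sub, eval_pow, eval_X, add_zero]

theorem eNu_eq (ha : a ∈ Set.Ioo (0 : ℝ) 1) (hh : h ≠ 0) (hP : IsMonicOrthogonal a a⁻¹ ν n P)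
    (hS : IsKernel a a⁻¹ ν n h a S) :
    PWZeros.eNu n ν a = a ^ ((ν + 1) / 2) * P.eval a := by
  rw [PWZeros.eNu, PWZeros.Eim, PWZeros.E_imaginary, Complex.ofReal_re, coeffC_eq ha hh hS,
    sum_coeff_mul_integral (ν := ν) ha hS.degree_lt _ _ n _ (fun j => ?_),
    hS.moment_X_pow_mul ha.1 (lt_inv_self ha) hP,
    show -Real.log a * -((ν + 1) / 2 + n) = -(((ν + 1) / 2 + n) * -Real.log a) by ring,
    exp_neg_mul_neg_log ha.1]
  · field_simp
    ring
  · rw [PWZeros.kappa]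
    push_cast
    ring

theorem fNu_eq (ha : a ∈ Set.Ioo (0 : ℝ) 1) (hh : h ≠ 0) (hP : IsMonicOrthogonal a a⁻¹ ν n P)
    (hS : IsKernel a a⁻¹ ν n h a⁻¹ S) :
    PWZeros.fNu n ν a = (-1) ^ n * (a ^ ((ν + 1) / 2))⁻¹ * P.eval a⁻¹ := by
  rw [PWZeros.fNu, PWZeros.Fim, PWZeros.F_imaginary, Complex.ofReal_re, coeffD_eq ha hh hS,
    sum_coeff_mul_integral (ν := ν) ha hS.degree_lt _ _ n _ (fun j => ?_),
    hS.moment_X_pow_mul ha.1 (lt_inv_self ha) hP,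
    show -(-Real.log a * -((ν + 1) / 2 + n)) = ((ν + 1) / 2 + n) * -Real.log a by ring,
    exp_mul_neg_log ha.1]
  · generalize (a ^ ((ν + 1) / 2))⁻¹ = α
    field_simp
    ring
  · rw [PWZeros.kappa]
    push_cast
    ring

/-- The integral of a kernel for the weight `u ^ (ν + 1)` against the weight `u ^ ν`. -/
theorem IsKernel.eval_zero_mul_moment (ha : 0 < a) {b : ℝ} (hab : a < b)
    (hP : IsMonicOrthogonal a b ν (m + 1) P) {T : ℝ[X]}
    (hT : IsKernel a b (ν + 1) (m + 1) h t T) :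
    t * (P.eval 0 * moment a b ν T) = h * (P.eval 0 - P.eval t) := by
  -- Split P = X·P₁ + P(0) and integrate against T and u^ν: P contributes zero by orthogonality, and
  -- X·P₁ is P₁ against u^(ν+1), where T evaluates at t.
  have hdiv := divX_mul_X_add P
  rw [coeff_zero_eq_eval_zero] at hdiv
  have hdeg : P.divX.degree < (m + 1 : ℕ) := by
    rw [← hP.degree_eq]
    exact degree_divX_lt hP.monic.ne_zero
  have h1 := hP.orthogonal T hT.degree_lt
  rw [← hdiv, show (P.divX * X + C (P.eval 0)) * T = X * (T * P.divX) + C (P.eval 0) * T by ring,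
    moment_add ha hab, moment_X_mul ha hab, moment_C_mul, hT.moment_mul _ hdeg] at h1
  have h2 := congrArg (eval t) hdiv
  simp only [eval_add, eval_mul, eval_X, eval_C] at h2
  linear_combination t * h1 - h * h2

theorem rpow_succ_half (ha : 0 < a) : a ^ ((ν + 1 + 1) / 2) = a ^ (ν / 2) * a := by
  rw [← Real.rpow_add_one ha.ne']
  congr 1
  ring

/-- The exponent ν/2 precedes the progression of ν + 1, so the kernel T for u^(ν+1) gets integrated
against u^ν. Division by P(0) is allowed since 0 lies outside [a, 1/a]. -/
theorem gNuSucc_eq (ha : a ∈ Set.Ioo (0 : ℝ) 1) (hh : h ≠ 0)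
    (hP : IsMonicOrthogonal a a⁻¹ ν (m + 1) P) {T : ℝ[X]}
    (hT : IsKernel a a⁻¹ (ν + 1) (m + 1) h a T) :
    PWZeros.gNuSucc (m + 1) ν a = a ^ (ν / 2) * (P.eval a / P.eval 0) := by
  have hP0 := hP.eval_ne_zero ha.1 (lt_inv_self ha) (Or.inl ha.1.le)
  have hmom := hT.eval_zero_mul_moment ha.1 (lt_inv_self ha) hP
  have hexp := exp_neg_mul_neg_log ha.1 (ν / 2) 0
  rw [Nat.cast_zero, add_zero, pow_zero, mul_one] at hexp
  rw [PWZeros.gNuSucc, PWZeros.Eim, PWZeros.E_imaginary, Complex.ofReal_re, coeffC_eq ha hh hT,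
    sum_coeff_mul_integral (ν := ν) ha hT.degree_lt _ _ 0 _ (fun j => ?_), pow_zero, one_mul,
    show -Real.log a * -(ν / 2) = -(ν / 2 * -Real.log a) by ring, hexp, rpow_succ_half ha.1]
  · have h1 : a * moment a a⁻¹ ν T = h * (P.eval 0 - P.eval a) / P.eval 0 := by
      rw [eq_div_iff hP0, ← hmom]
      ring
    rw [show -(a ^ (ν / 2) * a / h) * moment a a⁻¹ ν T =
      -(a ^ (ν / 2) / h) * (a * moment a a⁻¹ ν T) by ring, h1]
    field_simp
    ring
  · rw [PWZeros.kappa]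
    push_cast
    ring

theorem hNuSucc_eq (ha : a ∈ Set.Ioo (0 : ℝ) 1) (hh : h ≠ 0)
    (hP : IsMonicOrthogonal a a⁻¹ ν (m + 1) P) {T : ℝ[X]}
    (hT : IsKernel a a⁻¹ (ν + 1) (m + 1) h a⁻¹ T) :
    PWZeros.hNuSucc (m + 1) ν a =
      (-1) ^ (m + 1) * (a ^ (ν / 2))⁻¹ * (P.eval a⁻¹ / P.eval 0) := by
  have hP0 := hP.eval_ne_zero ha.1 (lt_inv_self ha) (Or.inl ha.1.le)
  have hmom := hT.eval_zero_mul_moment ha.1 (lt_inv_self ha) hP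
  have hexp := exp_mul_neg_log ha.1 (ν / 2) 0
  rw [Nat.cast_zero, add_zero, pow_zero, mul_one] at hexp
  rw [PWZeros.hNuSucc, PWZeros.Fim, PWZeros.F_imaginary, Complex.ofReal_re, coeffD_eq ha hh hT,
    sum_coeff_mul_integral (ν := ν) ha hT.degree_lt _ _ 0 _ (fun j => ?_), pow_zero, one_mul,
    show -(-Real.log a * -(ν / 2)) = ν / 2 * -Real.log a by ring, hexp, rpow_succ_half ha.1,
    mul_inv]
  · have h1 : a⁻¹ * moment a a⁻¹ ν T = h * (P.eval 0 - P.eval a⁻¹) / P.eval 0 := by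
      rw [eq_div_iff hP0, ← hmom]
      ring
    rw [show -((-1) ^ (m + 1) * ((a ^ (ν / 2))⁻¹ * a⁻¹) / h) * moment a a⁻¹ ν T =
      -((-1) ^ (m + 1) * (a ^ (ν / 2))⁻¹ / h) * (a⁻¹ * moment a a⁻¹ ν T) by ring, h1]
    generalize (a ^ (ν / 2))⁻¹ = α
    field_simp
    ring
  · rw [PWZeros.kappa]
    push_cast
    ring

/-! ### All quantities in terms of the values of the orthogonal polynomials -/

theorem coeff_zero_of_mul_eq {S : ℝ[X]} (ht : t ≠ 0)
    (hS : (X - C t) * S = C (t * Q.eval t) * P - C (P.eval t) * (X * Q)) :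
    S.coeff 0 = -(Q.eval t * P.eval 0) := by
  have h1 := congrArg (eval 0) hS
  simp only [eval_mul, eval_sub, eval_X, eval_C] at h1
  rw [coeff_zero_eq_eval_zero]
  apply mul_left_cancel₀ ht
  linear_combination -h1

/-- The values of all quantities in terms of `p_a = P(a)`, `p_b = P(1/a)`, `p_0 = P(0)`,
`q_a = Q(a)`, `q_b = Q(1/a)` and `h = ∫ Q(u)² u^(ν+1) du`, where `P` and `Q` are the monic
orthogonal polynomials of degrees `m + 1` and `m` for the weights `u ^ ν` and `u ^ (ν + 1)`. -/
theorem exists_values (m : ℕ) (ν : ℝ) (ha : a ∈ Set.Ioo (0 : ℝ) 1) :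
    ∃ pa pb p0 qa qb h : ℝ, pb ≠ 0 ∧ p0 ≠ 0 ∧ qb ≠ 0 ∧ h ≠ 0 ∧
      (a⁻¹ ^ (ν + 1) * (pb * qb) - a ^ (ν + 1) * (pa * qa) = (m + 1) * h) ∧
      PWZeros.eNu (m + 1) ν a = a ^ ((ν + 1) / 2) * pa ∧
      PWZeros.fNu (m + 1) ν a = (-1) ^ (m + 1) * (a ^ ((ν + 1) / 2))⁻¹ * pb ∧
      PWZeros.gNuSucc (m + 1) ν a = a ^ (ν / 2) * (pa / p0) ∧
      PWZeros.hNuSucc (m + 1) ν a = (-1) ^ (m + 1) * (a ^ (ν / 2))⁻¹ * (pb / p0) ∧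
      PWZeros.c (m + 1) ν 0 a = a ^ ((ν + 1) / 2) / h * (qa * p0) ∧
      PWZeros.d (m + 1) ν 0 a = (-1) ^ (m + 1) * (a ^ ((ν + 1) / 2))⁻¹ / h * (qb * p0) ∧
      PWZeros.c (m + 1) (ν + 1) (Fin.last m) a = -(a ^ (ν / 2) * a / h) * qa ∧
      PWZeros.d (m + 1) (ν + 1) (Fin.last m) a =
        -((-1) ^ (m + 1) * (a ^ (ν / 2) * a)⁻¹ / h) * qb ∧
      PWZeros.muCoeff (PWZeros.kappa (m + 1) ν) (-Real.log a) * ((a⁻¹ - a) * h) =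
        2 * (-1) ^ (m + 1) * (pa * (a⁻¹ * qb) - a * qa * pb) ∧
      PWZeros.muCoeff (PWZeros.kappa (m + 1) (ν + 1)) (-Real.log a) * ((a⁻¹ - a) * h) =
        2 * (-1) ^ (m + 1) * (pa * qb - qa * pb) := by
  have ha0 := ha.1
  have hab := lt_inv_self ha
  obtain ⟨P, hP⟩ := exists_isMonicOrthogonal ha0 hab ν (m + 1)
  obtain ⟨Q, hQ⟩ := exists_isMonicOrthogonal ha0 hab (ν + 1) m
  have hQa := hQ.eval_ne_zero ha0 hab (Or.inl le_rfl)
  have hQb := hQ.eval_ne_zero ha0 hab (Or.inr le_rfl)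
  have hh := (hQ.moment_mul_self_pos ha0 hab).ne'
  obtain ⟨Sa, hSa1, hSa2, hSa3⟩ := hP.exists_kernel ha0 hab hQ ha0.ne' hQa
  obtain ⟨Sb, hSb1, hSb2, hSb3⟩ := hP.exists_kernel ha0 hab hQ (inv_ne_zero ha0.ne') hQb
  obtain ⟨Ta, hTa1, hTa2, hTac, hTa3⟩ := hP.exists_kernel_succ ha0 hab hQ hQa
  obtain ⟨Tb, hTb1, hTb2, hTbc, hTb3⟩ := hP.exists_kernel_succ ha0 hab hQ hQb
  have hSa : IsKernel a a⁻¹ ν (m + 1) _ a Sa := ⟨hSa1, hSa3⟩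
  have hSb : IsKernel a a⁻¹ ν (m + 1) _ a⁻¹ Sb := ⟨hSb1, hSb3⟩
  have hTa : IsKernel a a⁻¹ (ν + 1) (m + 1) _ a Ta := ⟨hTa1, hTa3⟩
  have hTb : IsKernel a a⁻¹ (ν + 1) (m + 1) _ a⁻¹ Tb := ⟨hTb1, hTb3⟩
  refine ⟨P.eval a, P.eval a⁻¹, P.eval 0, Q.eval a, Q.eval a⁻¹, moment a a⁻¹ (ν + 1) (Q * Q),
    hP.eval_ne_zero ha0 hab (Or.inr le_rfl), hP.eval_ne_zero ha0 hab (Or.inl ha0.le), hQb, hh,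
    hP.boundary ha0 hab hQ, eNu_eq ha hh hP hSa, fNu_eq ha hh hP hSb, gNuSucc_eq ha hh hP hTa,
    hNuSucc_eq ha hh hP hTb, ?_, ?_, ?_, ?_, ?_, ?_⟩
  · rw [PWZeros.c, coeffC_eq ha hh hSa]
    beta_reduce
    rw [Fin.val_zero, coeff_zero_of_mul_eq ha0.ne' hSa2]
    ring
  · rw [PWZeros.d, coeffD_eq ha hh hSb]
    beta_reduce
    rw [Fin.val_zero, coeff_zero_of_mul_eq (inv_ne_zero ha0.ne') hSb2]
    ring
  · rw [PWZeros.c, coeffC_eq ha hh hTa]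
    beta_reduce
    rw [Fin.val_last, hTac, rpow_succ_half ha0]
  · rw [PWZeros.d, coeffD_eq ha hh hTb]
    beta_reduce
    rw [Fin.val_last, hTbc, rpow_succ_half ha0]
  -- The Christoffel-Darboux identity for the kernel at a, read at 1/a, yields the factor 1/a - a.
  · have h1 := congrArg (eval a⁻¹) hSa2
    simp only [eval_mul, eval_sub, eval_X, eval_C] at h1
    rw [muCoeff_eq_eval ha hh hSa, show ∀ s e h k : ℝ, -(2 * s * (e / h)) * (k * h) =
      -(2 * s * (k * e)) * (h / h) from fun s e h k => by ring, div_self hh, h1]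
    ring
  · have h1 := congrArg (eval a⁻¹) hTa2
    simp only [eval_mul, eval_sub, eval_X, eval_C] at h1
    rw [muCoeff_eq_eval ha hh hTa, show ∀ s e h k : ℝ, -(2 * s * (e / h)) * (k * h) =
      -(2 * s * (k * e)) * (h / h) from fun s e h k => by ring, div_self hh, h1]
    ring

end PowerWeight

namespace PWZeros

/-! ### The functions `X` and `Y` -/

theorem formulas_X_Y (m : ℕ) (ν : ℝ) {a : ℝ} (ha : a ∈ Set.Ioo (0 : ℝ) 1) (hm : 0 < m + 1) :
    hNuSucc (m + 1) ν a ≠ 0 ∧ fNu (m + 1) ν a ≠ 0 ∧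
    d (m + 1) ν 0 a ≠ 0 ∧ d (m + 1) (ν + 1) (Fin.last m) a ≠ 0 ∧
    X (m + 1) ν a = 1 / a * (eNu (m + 1) ν a / fNu (m + 1) ν a) ∧
    Y (m + 1) hm ν a =
      -(1 / a * (c (m + 1) (ν + 1) (Fin.last m) a / d (m + 1) (ν + 1) (Fin.last m) a)) ∧
    1 + a * X (m + 1) ν a * Y (m + 1) hm ν a ≠ 0 ∧
    muCoeff (kappa (m + 1) ν) (-Real.log a) =
      2 * (m + 1 : ℕ) * a / (1 - a ^ 2) * ((X (m + 1) ν a + a * Y (m + 1) hm ν a) /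
        (1 + a * X (m + 1) ν a * Y (m + 1) hm ν a)) ∧
    muCoeff (kappa (m + 1) (ν + 1)) (-Real.log a) =
      2 * (m + 1 : ℕ) * a / (1 - a ^ 2) * ((a * X (m + 1) ν a + Y (m + 1) hm ν a) /
        (1 + a * X (m + 1) ν a * Y (m + 1) hm ν a)) := by
  obtain ⟨pa, pb, p0, qa, qb, h, hpb, hp0, hqb, hh, hbd, he, hf, hg, hh', hc, hd, hcn, hdn,
    hmu, hmu'⟩ := PowerWeight.exists_values m ν ha
  have ha0 : a ≠ 0 := ha.1.ne'
  have ha1 : 1 - a ^ 2 ≠ 0 := by nlinarith [ha.1, ha.2]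
  have hαpos := Real.rpow_pos_of_pos ha.1 ((ν + 1) / 2)
  have hβpos := Real.rpow_pos_of_pos ha.1 (ν / 2)
  have hβ : a ^ (ν + 1) = a * (a ^ (ν / 2)) ^ 2 := by
    rw [← Real.rpow_natCast, ← Real.rpow_mul ha.1.le, Real.rpow_add_one ha0, mul_comm]
    congr 2
    push_cast
    ring
  have hα : (a ^ ((ν + 1) / 2)) ^ 2 = a * (a ^ (ν / 2)) ^ 2 := by
    rw [← hβ, ← Real.rpow_natCast, ← Real.rpow_mul ha.1.le]
    congr 1
    push_cast
    ring
  rw [Real.inv_rpow ha.1.le, hβ] at hbd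
  set α := a ^ ((ν + 1) / 2)
  set β := a ^ (ν / 2)
  obtain ⟨s, hs⟩ : ∃ s : ℝ, s = (-1) ^ (m + 1) := ⟨_, rfl⟩
  have hs2 : s * s = 1 := by rw [hs, ← mul_pow]; simp
  have hs0 : s ≠ 0 := left_ne_zero_of_mul_eq_one hs2
  have hsinv : s⁻¹ = s := inv_eq_of_mul_eq_one_left hs2
  rw [← hs] at hf hh' hd hdn hmu hmu'
  have hα0 : α ≠ 0 := hαpos.ne'
  have hβ0 : β ≠ 0 := hβpos.ne'
  have hX : X (m + 1) ν a = s * β ^ 2 * (pa / pb) := by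
    rw [X, hg, hh', show s * β ^ 2 = s⁻¹ * β ^ 2 by rw [hsinv]]
    field_simp
  have hY : Y (m + 1) hm ν a = -(s * (a * β ^ 2) * (qa / qb)) := by
    rw [Y, show (⟨0, hm⟩ : Fin (m + 1)) = 0 from rfl, hc, hd, ← hα,
      show s * α ^ 2 = s⁻¹ * α ^ 2 by rw [hsinv]]
    field_simp
  -- The boundary identity in disguise: since β² = a^ν, 1 + aXY is the boundary difference times
  -- a^(ν+1)/(P(1/a)Q(1/a)).
  have hden : 1 + a * X (m + 1) ν a * Y (m + 1) hm ν a =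
      a * β ^ 2 * ((m + 1) * h) / (pb * qb) := by
    rw [hX, hY, ← hbd]
    field_simp
    linear_combination (-(a ^ 2 * β ^ 4 * pa * qa)) * hs2
  have hm0 : (m + 1 : ℝ) ≠ 0 := by positivity
  refine ⟨?_, ?_, ?_, ?_, ?_, ?_, ?_, ?_, ?_⟩
  · rw [hh']
    positivity
  · rw [hf]
    positivity
  · rw [hd]
    positivity
  · rw [hdn]
    exact mul_ne_zero (neg_ne_zero.2 (by positivity)) hqb
  · rw [hX, he, hf, show s * β ^ 2 = s⁻¹ * β ^ 2 by rw [hsinv]]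
    field_simp
    linear_combination (-pa) * hα
  · rw [hY, hcn, hdn, show s * (a * β ^ 2) = s⁻¹ * (a * β ^ 2) by rw [hsinv]]
    field_simp
  · rw [hden]
    positivity
  · have hk : (a⁻¹ - a) * h ≠ 0 := mul_ne_zero (sub_ne_zero.2 (PowerWeight.lt_inv_self ha).ne') hh
    rw [hden, hX, hY, eq_div_of_mul_eq hk hmu]
    push_cast
    field_simp
    ring
  · have hk : (a⁻¹ - a) * h ≠ 0 := mul_ne_zero (sub_ne_zero.2 (PowerWeight.lt_inv_self ha).ne') hh
    rw [hden, hX, hY, eq_div_of_mul_eq hk hmu']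
    push_cast
    field_simp
    ring

/-! ### Riccati equations for X and Y in the variable a. -/

theorem hasDerivAt_neg_log {a : ℝ} (ha : 0 < a) :
    HasDerivAt (fun a => -Real.log a) (-a⁻¹) a :=
  (Real.hasDerivAt_log ha.ne').fun_neg

theorem hasDerivAt_re_comp_neg_log {f : ℝ → ℂ} {f' : ℂ} {a : ℝ} (ha : 0 < a)
    (hf : HasDerivAt f f' (-Real.log a)) :
    HasDerivAt (fun a => (f (-Real.log a)).re) (-a⁻¹ * f'.re) a := by
  have h1 : HasDerivAt (fun s => (f s).re) f'.re (-Real.log a) :=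
    Complex.reCLM.hasFDerivAt.comp_hasDerivAt _ hf
  exact (h1.comp a (hasDerivAt_neg_log ha)).congr_deriv (mul_comm _ _)

theorem hasDerivAt_Eim (n : ℕ) (ν t : ℝ) {a : ℝ} (ha : a ∈ Set.Ioo (0 : ℝ) 1) :
    HasDerivAt (Eim n ν t)
      (-a⁻¹ * (t * Eim n ν t a + muCoeff (kappa n ν) (-Real.log a) * Fim n ν t a)) a := by
  have h := hasDerivAt_re_comp_neg_log ha.1 (hasDerivAt_E (PowerWeight.isUnit_det_gram_kappa n ν)
    (neg_pos.2 (Real.log_neg ha.1 ha.2)) (Complex.I * (t : ℂ)))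
  refine h.congr_deriv ?_
  rw [show -Complex.I * (Complex.I * (t : ℂ)) = (t : ℂ) by
    linear_combination (-(t : ℂ)) * Complex.I_mul_I, Complex.add_re, Complex.re_ofReal_mul,
    Complex.re_ofReal_mul]
  rfl

theorem hasDerivAt_Fim (n : ℕ) (ν t : ℝ) {a : ℝ} (ha : a ∈ Set.Ioo (0 : ℝ) 1) :
    HasDerivAt (Fim n ν t)
      (-a⁻¹ * (-t * Fim n ν t a + muCoeff (kappa n ν) (-Real.log a) * Eim n ν t a)) a := by
  have h := hasDerivAt_re_comp_neg_log ha.1 (hasDerivAt_F (PowerWeight.isUnit_det_gram_kappa n ν)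
    (neg_pos.2 (Real.log_neg ha.1 ha.2)) (Complex.I * (t : ℂ)))
  refine h.congr_deriv ?_
  rw [show Complex.I * (Complex.I * (t : ℂ)) = ((-t : ℝ) : ℂ) by
    push_cast
    linear_combination (t : ℂ) * Complex.I_mul_I, Complex.add_re, Complex.re_ofReal_mul,
    Complex.re_ofReal_mul]
  rfl

/-- The quotient rule on the Krein system at t = -ν/2: the diagonal terms ±t leave 2t = -ν, and a
d/da = -d/dx flips the sign. -/
theorem hasDerivAt_X (n : ℕ) (ν : ℝ) {a : ℝ} (ha : a ∈ Set.Ioo (0 : ℝ) 1)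
    (h0 : hNuSucc n ν a ≠ 0) :
    HasDerivAt (X n ν) (a⁻¹ * (ν * X n ν a -
      (1 - X n ν a ^ 2) * muCoeff (kappa n (ν + 1)) (-Real.log a))) a := by
  have hg := hasDerivAt_Eim n (ν + 1) (-(ν / 2)) ha
  have hh := hasDerivAt_Fim n (ν + 1) (-(ν / 2)) ha
  have h0' : Fim n (ν + 1) (-(ν / 2)) a ≠ 0 := h0
  refine (hg.div hh h0').congr_deriv ?_
  rw [X, gNuSucc, hNuSucc]
  have ha0 : a ≠ 0 := ha.1.ne'
  field_simp
  ring

theorem hasDerivAt_c (n : ℕ) (ν : ℝ) (j : Fin n) {a : ℝ} (ha : a ∈ Set.Ioo (0 : ℝ) 1) :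
    HasDerivAt (c n ν j) (-a⁻¹ * (kappa n ν j * c n ν j a +
      muCoeff (kappa n ν) (-Real.log a) * d n ν j a)) a := by
  have h := hasDerivAt_coeffC (PowerWeight.isUnit_det_gram_kappa n ν)
    (neg_pos.2 (Real.log_neg ha.1 ha.2)) j
  exact (h.comp a (hasDerivAt_neg_log ha.1)).congr_deriv (mul_comm _ _)

theorem hasDerivAt_d (n : ℕ) (ν : ℝ) (j : Fin n) {a : ℝ} (ha : a ∈ Set.Ioo (0 : ℝ) 1) :
    HasDerivAt (d n ν j) (-a⁻¹ * (-(kappa n ν j * d n ν j a) +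
      muCoeff (kappa n ν) (-Real.log a) * c n ν j a)) a := by
  have h := hasDerivAt_coeffD (PowerWeight.isUnit_det_gram_kappa n ν)
    (neg_pos.2 (Real.log_neg ha.1 ha.2)) j
  exact (h.comp a (hasDerivAt_neg_log ha.1)).congr_deriv (mul_comm _ _)

/-- The first exponent is (ν + 1)/2, so the diagonal terms ±κ_1 combine to ν + 1; the sign in the
definition of Y makes μ enter with a plus. -/
theorem hasDerivAt_Y (n : ℕ) (hn : 0 < n) (ν : ℝ) {a : ℝ} (ha : a ∈ Set.Ioo (0 : ℝ) 1)
    (h0 : d n ν ⟨0, hn⟩ a ≠ 0) :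
    HasDerivAt (Y n hn ν) (a⁻¹ * (-(ν + 1) * Y n hn ν a +
      (1 - Y n hn ν a ^ 2) * muCoeff (kappa n ν) (-Real.log a))) a := by
  have hc := hasDerivAt_c n ν ⟨0, hn⟩ ha
  have hd := hasDerivAt_d n ν ⟨0, hn⟩ ha
  refine (hc.fun_div hd h0).fun_neg.congr_deriv ?_
  rw [Y, kappa, Nat.cast_zero]
  have ha0 : a ≠ 0 := ha.1.ne'
  field_simp
  ring

end PWZeros

theorem mainTheorem3 (n : ℕ) (hn : 0 < n) (ν : ℝ) :
    -- `E_ν`, `F_ν` are well defined by their trivial zeros, are real on the imaginary axis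
    -- and give the reproducing kernel of `PW_x(ν, n)`
    (∀ x : ℝ, 0 < x →
      (∀ c : Fin n → ℂ,
        (∀ j, PWZeros.perturbE (PWZeros.kappa n ν) x c (PWZeros.zero (PWZeros.kappa n ν) j) = 0) ↔
          c = fun j => (PWZeros.coeffC (PWZeros.kappa n ν) x j : ℂ)) ∧
      (∀ d : Fin n → ℂ,
        (∀ j, PWZeros.perturbF (PWZeros.kappa n ν) x d (PWZeros.zero (PWZeros.kappa n ν) j) = 0) ↔
          d = fun j => (PWZeros.coeffD (PWZeros.kappa n ν) x j : ℂ)) ∧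
      (∀ t : ℝ, (PWZeros.E (PWZeros.kappa n ν) x (Complex.I * (t : ℂ))).im = 0 ∧
        (PWZeros.F (PWZeros.kappa n ν) x (Complex.I * (t : ℂ))).im = 0) ∧
      PWZeros.ComputesEvaluators (PWZeros.kappa n ν) x) ∧
    -- `X` and `Y` are well defined, with their two expressions
    (∀ a ∈ Set.Ioo (0 : ℝ) 1,
      PWZeros.hNuSucc n ν a ≠ 0 ∧ PWZeros.fNu n ν a ≠ 0 ∧
      PWZeros.d n ν ⟨0, hn⟩ a ≠ 0 ∧ PWZeros.d n (ν + 1) ⟨n - 1, Nat.sub_one_lt_of_lt hn⟩ a ≠ 0 ∧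
      PWZeros.X n ν a = 1 / a * (PWZeros.eNu n ν a / PWZeros.fNu n ν a) ∧
      PWZeros.Y n hn ν a =
        -(1 / a * (PWZeros.c n (ν + 1) ⟨n - 1, Nat.sub_one_lt_of_lt hn⟩ a /
          PWZeros.d n (ν + 1) ⟨n - 1, Nat.sub_one_lt_of_lt hn⟩ a)) ∧
      1 + a * PWZeros.X n ν a * PWZeros.Y n hn ν a ≠ 0) ∧
    -- the mu-functions `μ_ν` and `μ_{ν+1}` exist, are unique, and have the stated expressions
    (∀ μ : ℝ → ℝ, PWZeros.IsMuFunction (PWZeros.kappa n ν) μ ↔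
      ∀ a ∈ Set.Ioo (0 : ℝ) 1,
        μ a = 2 * n * a / (1 - a ^ 2) * ((PWZeros.X n ν a + a * PWZeros.Y n hn ν a) /
          (1 + a * PWZeros.X n ν a * PWZeros.Y n hn ν a))) ∧
    (∀ μ : ℝ → ℝ, PWZeros.IsMuFunction (PWZeros.kappa n (ν + 1)) μ ↔
      ∀ a ∈ Set.Ioo (0 : ℝ) 1,
        μ a = 2 * n * a / (1 - a ^ 2) * ((a * PWZeros.X n ν a + PWZeros.Y n hn ν a) /
          (1 + a * PWZeros.X n ν a * PWZeros.Y n hn ν a))) ∧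
    -- the nonlinear differential system
    (∀ a ∈ Set.Ioo (0 : ℝ) 1,
      DifferentiableAt ℝ (PWZeros.X n ν) a ∧ DifferentiableAt ℝ (PWZeros.Y n hn ν) a ∧
      a * deriv (PWZeros.X n ν) a =
        ν * PWZeros.X n ν a - (1 - PWZeros.X n ν a ^ 2) *
          (2 * n * a / (1 - a ^ 2)) * ((a * PWZeros.X n ν a + PWZeros.Y n hn ν a) /
            (1 + a * PWZeros.X n ν a * PWZeros.Y n hn ν a)) ∧
      a * deriv (PWZeros.Y n hn ν) a =
        -(ν + 1) * PWZeros.Y n hn ν a + (1 - PWZeros.Y n hn ν a ^ 2) *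
          (2 * n * a / (1 - a ^ 2)) * ((PWZeros.X n ν a + a * PWZeros.Y n hn ν a) /
            (1 + a * PWZeros.X n ν a * PWZeros.Y n hn ν a))) := by
  obtain ⟨m, rfl⟩ : ∃ m, n = m + 1 := ⟨n - 1, (Nat.sub_add_cancel hn).symm⟩
  have hval := fun (a : ℝ) (ha : a ∈ Set.Ioo (0 : ℝ) 1) => PWZeros.formulas_X_Y m ν ha hn
  have hunit := PowerWeight.isUnit_det_gram_kappa (m + 1) ν
  have hexp : ∀ x : ℝ, 0 < x → Real.exp (-x) ∈ Set.Ioo (0 : ℝ) 1 := fun x hx =>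
    ⟨Real.exp_pos _, Real.exp_lt_one_iff.2 (neg_neg_of_pos hx)⟩
  refine ⟨fun x hx => ⟨PWZeros.perturbE_vanishes_iff (hunit x hx),
    PWZeros.perturbF_vanishes_iff (hunit x hx), fun t => ?_,
    PWZeros.computesEvaluators_of_isUnit_det hx (hunit x hx)⟩, fun a ha => ?_, fun μ => ?_,
    fun μ => ?_, fun a ha => ?_⟩
  · rw [PWZeros.E_imaginary, PWZeros.F_imaginary]
    exact ⟨Complex.ofReal_im _, Complex.ofReal_im _⟩
  · obtain ⟨h1, h2, h3, h4, h5, h6, h7, -, -⟩ := hval a ha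
    exact ⟨h1, h2, h3, h4, h5, h6, h7⟩
  · rw [PWZeros.isMuFunction_iff hunit fun x hx => ?_]
    · exact forall₂_congr fun a ha => by rw [(hval a ha).2.2.2.2.2.2.2.1]
    -- Uniqueness of μ needs a point where F is non-zero: f_ν ≠ 0 provides it here, h_{ν+1} ≠ 0 for
    -- ν + 1.
    · refine ⟨Complex.I * ((-((ν + 1) / 2 + (m + 1 : ℕ)) : ℝ) : ℂ), fun h0 => ?_⟩
      apply (hval _ (hexp x hx)).2.1
      rw [PWZeros.fNu, PWZeros.Fim, Real.log_exp, neg_neg, h0, Complex.zero_re]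
  · rw [PWZeros.isMuFunction_iff (PowerWeight.isUnit_det_gram_kappa (m + 1) (ν + 1))
      fun x hx => ?_]
    · exact forall₂_congr fun a ha => by rw [(hval a ha).2.2.2.2.2.2.2.2]
    · refine ⟨Complex.I * ((-(ν / 2) : ℝ) : ℂ), fun h0 => ?_⟩
      apply (hval _ (hexp x hx)).1
      rw [PWZeros.hNuSucc, PWZeros.Fim, Real.log_exp, neg_neg, h0, Complex.zero_re]
  · obtain ⟨h1, -, h3, -, -, -, -, hmu, hmu'⟩ := hval a ha
    have ha0 : a ≠ 0 := ha.1.ne'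
    have hX := PWZeros.hasDerivAt_X (m + 1) ν ha h1
    have hY := PWZeros.hasDerivAt_Y (m + 1) hn ν ha h3
    refine ⟨hX.differentiableAt, hY.differentiableAt, ?_, ?_⟩
    · rw [hX.deriv, mul_inv_cancel_left₀ ha0, hmu', mul_assoc (1 - _)]
    · rw [hY.deriv, mul_inv_cancel_left₀ ha0, hmu, mul_assoc (1 - _)]
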